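/- Let $X=(X_t,\,t\ge 0)$ be a real homogeneous Lévy process with a.s. right continuous trajectories, $X_0=0$, and generating triplet $(a,\gamma,\nu)$, i.e. $$\mathrm E e^{i\theta X_t}=\exp\Big\{t\Big(i\gamma\theta-\tfrac12 a^2\theta^2+\int_{\mathbb R}\big(e^{iu\theta}-1-iu\theta\,\mathbf 1(|u|\le 1)\big)\nu(du)\Big)\Big\},\qquad \theta\in\mathbb R,$$ where $\gamma\in\mathbb R$, $a\ge 0$ and $\nu$ is a measure on $\mathbb R$ with $\int\min(u^2,1)\,\nu(du)<\infty$. Put $K(u):=\nu((-\infty,-u]\cup[u,\infty))$ for $u>0$. For $k\ge 0$ let $\Delta^{2,n}_kX:=X_{(k+2)/n}-2X_{(k+1)/n}+X_{k/n}$, let $\psi(x,y):=\frac{|x+y|}{|x|+|y|}$ with the convention $\frac00:=1$, and for even $n\ge4$ let $$\tilde R^{2,n}:=\frac1{n/2-1}\sum_{k=0}^{(n-4)/2}\psi\big(\Delta^{2,n}_{2k}X,\Delta^{2,n}_{2k+2}X\big).$$ Assume either $a>0$, in which case put $\alpha:=2$, or else $a=0$ and $K(u)\sim c\,u^{-\alpha}$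 as $u\downarrow0$ for some $0<\alpha\le2$ and $c>0$. Let $Z_\alpha$ be a standard $\alpha$-stable random variable, $\mathrm E e^{i\theta Z_\alpha}=e^{-|\theta|^\alpha}$, and let $Z^{(1)}_\alpha,Z^{(2)}_\alpha,Z^{(3)}_\alpha$ be independent copies of $Z_\alpha$. Then: (i) If $X^{(1)},X^{(2)}$ are independent copies of $X$, then, as $t\downarrow 0$, $t^{-1/\alpha}\big(X^{(1)}_t-X^{(2)}_t\big)$ converges in law to $\tilde c\,Z_\alpha$, where $\tilde c=a$ if $a>0$, and, if $a=0$, $\tilde c>0$ is a constant depending only on $\alpha$ and $c$. (ii) With $\tilde\Lambda(\alpha):=\mathrm E\,\psi\big(Z^{(1)}_\alpha,Z^{(2)}_\alpha\big)$, as $n\to\infty$ along even $n$, $\mathrm E\tilde R^{2,n}\to\tilde\Lambda(\alpha)$ and $\tilde R^{2,n}\to\tilde\Lambda(\alpha)$ almost surely. (iii) With $\tilde\sigma^2(\alpha):=2\,\mathrm{var}\big(\psi(Z^{(1)}_\alpha,Z^{(2)}_\alpha)\big)+4\,\mathrm{cov}\big(\psi(Z^{(1)}_\alpha,Z^{(2)}_\alpha),\psi(Z^{(2)}_\alpha,Z^{(3)}_\alpha)\big)$,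 as $n\to\infty$ along even $n$, $\sqrt n\,\big(\tilde R^{2,n}-\mathrm E\tilde R^{2,n}\big)$ converges in law to $\mathcal N(0,\tilde\sigma^2(\alpha))$. -/

import Mathlib

open MeasureTheory ProbabilityTheory Filter Topology Asymptotics
open scoped NNReal ENNReal

namespace LevyIR

noncomputable section

/-- `X` is a real (homogeneous) Lévy process under `P`: it starts at `0`, has stationary independent
increments, and its trajectories are almost surely right continuous. -/
structure IsLevyProcess {Ω : Type*} [MeasurableSpace Ω] (X : ℝ≥0 → Ω → ℝ) (P : Measure Ω) :
    Prop where
  measurable : ∀ t, Measurable (X t)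
  zero : ∀ᵐ ω ∂P, X 0 ω = 0
  indepIncrements : HasIndepIncrements X P
  stationary : ∀ s t : ℝ≥0, IdentDistrib (fun ω ↦ X (s + t) ω - X s ω) (X t) P P
  rightContinuous : ∀ᵐ ω ∂P, ∀ t : ℝ≥0, ContinuousWithinAt (fun s ↦ X s ω) (Set.Ici t) t

/-- The Lévy–Khintchine exponent
`iγθ - a²θ²/2 + ∫ (exp(iuθ) - 1 - iuθ 1(|u| ≤ 1)) ν(du)`. -/
def levyExponent (a γ : ℝ) (ν : Measure ℝ) (θ : ℝ) : ℂ :=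
  Complex.I * γ * θ - (a : ℂ) ^ 2 * (θ : ℂ) ^ 2 / 2 +
    ∫ u : ℝ, (Complex.exp (Complex.I * u * θ) - 1 -
      (if |u| ≤ 1 then Complex.I * u * θ else 0)) ∂ν

/-- `(a, γ, ν)` is the generating triplet of `X`. A possible mass of `ν` at `0` would play no role
in any of the integrals and tails considered, so it is not excluded. -/
structure HasGeneratingTriplet {Ω : Type*} [MeasurableSpace Ω] (X : ℝ≥0 → Ω → ℝ) (P : Measure Ω)
    (a γ : ℝ) (ν : Measure ℝ) : Prop where
  nonneg : 0 ≤ a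
  levyMeasure : ∫⁻ u : ℝ, ENNReal.ofReal (min (u ^ 2) 1) ∂ν < ∞
  charFun_eq : ∀ (t : ℝ≥0) (θ : ℝ),
    charFun (P.map (X t)) θ = Complex.exp ((t : ℝ) * levyExponent a γ ν θ)

/-- The symmetrized tail `K(u) = ν((-∞, -u] ∪ [u, ∞))`. -/
def symTail (ν : Measure ℝ) (u : ℝ) : ℝ := ν.real (Set.Iic (-u) ∪ Set.Ici u)

/-- `ψ(x, y) = |x + y| / (|x| + |y|)`, with the convention `0 / 0 = 1`. -/
def psi (x y : ℝ) : ℝ := if x = 0 ∧ y = 0 then 1 else |x + y| / (|x| + |y|)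

/-- The second order increment
`Δ^{2,n}_k f = f((k+2)/n) - 2 f((k+1)/n) + f(k/n)`. -/
def secondIncr (n k : ℕ) (f : ℝ≥0 → ℝ) : ℝ :=
  f (((k + 2 : ℕ) : ℝ≥0) / n) - 2 * f (((k + 1 : ℕ) : ℝ≥0) / n) + f ((k : ℝ≥0) / n)

/-- The modified increment ratio statistic (used for even `n ≥ 4`)
`(n/2 - 1)⁻¹ ∑_{k=0}^{(n-4)/2} ψ(Δ^{2,n}_{2k} X, Δ^{2,n}_{2k+2} X)`. The sum has `n/2 - 1` terms. -/
def irStat {Ω : Type*} (X : ℝ≥0 → Ω → ℝ) (n : ℕ) (ω : Ω) : ℝ :=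
  1 / ((n : ℝ) / 2 - 1) * ∑ k ∈ Finset.range (n / 2 - 1),
    psi (secondIncr n (2 * k) (fun t ↦ X t ω)) (secondIncr n (2 * k + 2) (fun t ↦ X t ω))

/-- `(X₁, X₂)` are independent copies of the process `X` (as random elements of `ℝ^[0,∞)`),
defined on a possibly different probability space. -/
structure AreIndepCopies {Ω Ω' : Type*} [MeasurableSpace Ω] [MeasurableSpace Ω']
    (X₁ X₂ : ℝ≥0 → Ω' → ℝ) (P' : Measure Ω') (X : ℝ≥0 → Ω → ℝ) (P : Measure Ω) : Prop where
  copy_fst : IdentDistrib (fun ω t ↦ X₁ t ω) (fun ω t ↦ X t ω) P' P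
  copy_snd : IdentDistrib (fun ω t ↦ X₂ t ω) (fun ω t ↦ X t ω) P' P
  indep : IndepFun (fun ω t ↦ X₁ t ω) (fun ω t ↦ X₂ t ω) P'

/-- `S` is the law of a standard symmetric `α`-stable random variable, that is
`E exp(iθZ) = exp(-|θ|^α)`. -/
def IsStdStable (α : ℝ) (S : Measure ℝ) : Prop :=
  ∀ θ : ℝ, charFun S θ = Complex.exp (-((|θ| ^ α : ℝ) : ℂ))

/-- The joint law of three independent random variables `Z⁽¹⁾, Z⁽²⁾, Z⁽³⁾` with common law `S`;
they are realized as the coordinates `z 0, z 1, z 2`. -/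
def threeCopies (S : Measure ℝ) : Measure (Fin 3 → ℝ) := Measure.pi fun _ ↦ S

/-- `E ψ(Z⁽¹⁾, Z⁽²⁾)`. -/
def limitMean (S : Measure ℝ) : ℝ := ∫ z, psi (z 0) (z 1) ∂(threeCopies S)

/-- `2 var ψ(Z⁽¹⁾, Z⁽²⁾) + 4 cov(ψ(Z⁽¹⁾, Z⁽²⁾), ψ(Z⁽²⁾, Z⁽³⁾))`. -/
def limitVariance (S : Measure ℝ) : ℝ :=
  2 * variance (fun z ↦ psi (z 0) (z 1)) (threeCopies S) +
    4 * covariance (fun z ↦ psi (z 0) (z 1)) (fun z ↦ psi (z 1) (z 2)) (threeCopies S)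

end

end LevyIR

/-!
Write `q(θ) = a² θ² / 2 + ∫ (1 - cos (u θ)) dν` (`symExponent`) for the exponent of the symmetrized
process, so that `|E exp(iθ X_t)|² = exp(-2 t q(θ))`. Both the difference of two independent copies
of `X_t` and the second order increment `Δ^{2,n}_{2k} X` with `t = 1 / n` are differences of two
independent variables distributed as `X_t`, so their characteristic function is `exp(-2 t q(θ))`.
Everything depends on the growth of `q` at infinity, `2 q(θ) ∼ (c' θ)^α` (`HasStableGrowth`).
If `a > 0` the jumps contribute only `o(θ²)`. If `a = 0`, a layer cake formula compares
`∫ (1 - cos (u θ)) dν` with the same integral for the density `α u^(-α-1)`, up to the jumps of size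
at least `M / θ`, which are negligible as `M → ∞`; for `α = 2` the tail condition contradicts
`∫ min(u², 1) dν < ∞`. Replacing `θ` by `t^(-1/α) θ` makes the characteristic functions converge, so
Lévy's continuity theorem yields at once the existence of the stable law `S` and the small time
limit (`HasStableGrowth.tendsto_map`).

For each `n` the increments `Δ^{2,n}_{2k} X` are i.i.d. in `k` (`IsLevyProcess.isIID_evenIncr`).
As `psi` is bounded, invariant under scaling and continuous off the origin, and `S` has no atom at
`0`, the mean of `psi` over a pair of consecutive increments, its variance, and the covariance over
overlapping pairs converge to the corresponding quantities for independent copies under `S`.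

The statistic is an average of the bounded variables `psi (Y k) (Y (k + 1))` with `Y` i.i.d., a
1-dependent stationary row. The even and the odd terms separately are sums of independent variables,
so Hoeffding's inequality bounds the fluctuation by a geometric sequence, and the Borel–Cantelli
lemma gives almost sure convergence, although the rows of the array are dependent
(`ae_tendsto_average`). For the central limit theorem (`tendsto_charFun_array`) the row is cut into
blocks of a fixed length separated by single terms. The blocks are i.i.d., which handles their sum
through a second order expansion of the characteristic function; the separating terms have a small
variance. Letting the number of terms tend to infinity first and the block length afterwards
identifies the Gaussian limit.
-/

namespace LevyIR

/-! ### The symmetrized Lévy–Khintchine exponent -/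

/-- The jump part `∫ (1 - cos (uθ)) ν(du)` of minus the real part of the Lévy–Khintchine exponent. -/
noncomputable def jumpExponent (ν : Measure ℝ) (θ : ℝ) : ℝ := ∫ u, (1 - Real.cos (u * θ)) ∂ν

/-- Minus the real part of the Lévy–Khintchine exponent. -/
noncomputable def symExponent (a : ℝ) (ν : Measure ℝ) (θ : ℝ) : ℝ :=
  a ^ 2 * θ ^ 2 / 2 + jumpExponent ν θ

/-- `ν` integrates `u ↦ min (u²) 1`; mass at the origin is allowed. -/
def IsLevyMeasure (ν : Measure ℝ) : Prop := ∫⁻ u : ℝ, ENNReal.ofReal (min (u ^ 2) 1) ∂ν < ∞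

lemma IsLevyMeasure.integrable_min {ν : Measure ℝ} (h : IsLevyMeasure ν) :
    Integrable (fun u : ℝ ↦ min (u ^ 2) 1) ν := by
  refine ⟨by fun_prop, ?_⟩
  rw [hasFiniteIntegral_iff_ofReal (ae_of_all _ fun u ↦ by positivity)]
  exact h

lemma one_sub_cos_nonneg (x : ℝ) : 0 ≤ 1 - Real.cos x := by linarith [Real.cos_le_one x]

lemma one_sub_cos_le_two (x : ℝ) : 1 - Real.cos x ≤ 2 := by linarith [Real.neg_one_le_cos x]

lemma one_sub_cos_le_sq (x : ℝ) : 1 - Real.cos x ≤ x ^ 2 / 2 := by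
  linarith [Real.one_sub_sq_div_two_le_cos (x := x)]

lemma one_sub_cos_mul_le (u θ : ℝ) :
    1 - Real.cos (u * θ) ≤ (θ ^ 2 / 2 + 2) * min (u ^ 2) 1 := by
  rcases le_total (u ^ 2) 1 with h | h
  · rw [min_eq_left h]
    nlinarith [one_sub_cos_le_sq (u * θ), sq_nonneg u]
  · rw [min_eq_right h]
    nlinarith [one_sub_cos_le_two (u * θ), sq_nonneg θ]

lemma IsLevyMeasure.integrable_one_sub_cos {ν : Measure ℝ} (h : IsLevyMeasure ν) (θ : ℝ) :
    Integrable (fun u ↦ 1 - Real.cos (u * θ)) ν := by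
  refine (h.integrable_min.const_mul (θ ^ 2 / 2 + 2)).mono' (by fun_prop) (ae_of_all _ fun u ↦ ?_)
  rw [Real.norm_of_nonneg (one_sub_cos_nonneg _)]
  exact one_sub_cos_mul_le u θ

lemma jumpExponent_nonneg (ν : Measure ℝ) (θ : ℝ) : 0 ≤ jumpExponent ν θ :=
  integral_nonneg fun _ ↦ one_sub_cos_nonneg _

lemma symExponent_abs (a : ℝ) (ν : Measure ℝ) (θ : ℝ) :
    symExponent a ν |θ| = symExponent a ν θ := by
  have h (u : ℝ) : Real.cos (u * |θ|) = Real.cos (u * θ) := by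
    rcases abs_choice θ with h | h <;> simp [h]
  simp [symExponent, jumpExponent, h]

lemma norm_exp_I_mul_sub_one_sub_le (x : ℝ) :
    ‖Complex.exp (Complex.I * x) - 1 - Complex.I * x‖ ≤ 3 * x ^ 2 := by
  have hx : ‖Complex.I * x‖ = |x| := by simp
  rcases le_total |x| 1 with h | h
  · have := Complex.norm_exp_sub_one_sub_id_le (x := Complex.I * x) (by rw [hx]; exact h)
    rw [hx, sq_abs] at this
    nlinarith [sq_nonneg x]
  · have h1 : ‖Complex.exp (Complex.I * x) - 1‖ ≤ 2 := by
      refine (norm_sub_le _ _).trans ?_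
      rw [Complex.norm_exp_I_mul_ofReal]
      norm_num
    have h2 := norm_sub_le (Complex.exp (Complex.I * x) - 1) (Complex.I * x)
    rw [hx] at h2
    nlinarith [sq_abs x]

lemma IsLevyMeasure.integrable_exponent {ν : Measure ℝ} (h : IsLevyMeasure ν) (θ : ℝ) :
    Integrable (fun u : ℝ ↦ Complex.exp (Complex.I * u * θ) - 1 -
      (if |u| ≤ 1 then Complex.I * u * θ else 0)) ν := by
  refine (h.integrable_min.const_mul (3 * θ ^ 2 + 2)).mono' ?_ (ae_of_all _ fun u ↦ ?_)
  · refine (Measurable.aestronglyMeasurable ?_)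
    refine Measurable.sub (by fun_prop) (Measurable.ite ?_ (by fun_prop) (by fun_prop))
    exact measurableSet_le (by fun_prop) (by fun_prop)
  · have hc : Complex.I * u * θ = Complex.I * ((u * θ : ℝ) : ℂ) := by push_cast; ring
    rw [hc]
    split_ifs with hu
    · have hu' : u ^ 2 ≤ 1 := by rwa [sq_le_one_iff_abs_le_one]
      rw [min_eq_left hu']
      nlinarith [norm_exp_I_mul_sub_one_sub_le (u * θ), sq_nonneg u]
    · have hu' : 1 ≤ u ^ 2 := by
        rw [one_le_sq_iff_one_le_abs]; linarith
      rw [min_eq_right hu', sub_zero]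
      refine (norm_sub_le _ _).trans ?_
      rw [Complex.norm_exp_I_mul_ofReal, norm_one]
      nlinarith [sq_nonneg θ]

lemma re_levyExponent {a γ : ℝ} {ν : Measure ℝ} (h : IsLevyMeasure ν) (θ : ℝ) :
    (levyExponent a γ ν θ).re = -symExponent a ν θ := by
  have h1 : (∫ u : ℝ, (Complex.exp (Complex.I * u * θ) - 1 -
      (if |u| ≤ 1 then Complex.I * u * θ else 0)) ∂ν).re = -jumpExponent ν θ := by
    have := integral_re (h.integrable_exponent θ)
    simp only [RCLike.re_eq_complex_re] at this
    rw [← this, jumpExponent, ← integral_neg]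
    congr 1 with u
    have hc : Complex.I * u * θ = ((u * θ : ℝ) : ℂ) * Complex.I := by push_cast; ring
    rw [hc]
    simp only [Complex.sub_re, Complex.exp_ofReal_mul_I_re, Complex.one_re]
    split_ifs <;> simp
  rw [levyExponent, Complex.add_re, h1, symExponent]
  have h2 : (Complex.I * γ * θ - (a : ℂ) ^ 2 * (θ : ℂ) ^ 2 / 2) =
      ((-(a ^ 2 * θ ^ 2 / 2) : ℝ) : ℂ) + ((γ * θ : ℝ) : ℂ) * Complex.I := by
    push_cast; ring
  rw [h2, Complex.add_re, Complex.ofReal_re, Complex.re_ofReal_mul, Complex.I_re]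
  ring

/-! ### Growth of the exponent at infinity -/

/-- The jumps contribute less than any Brownian component at high frequencies. -/
lemma IsLevyMeasure.tendsto_jumpExponent_div_sq {ν : Measure ℝ} (h : IsLevyMeasure ν) :
    Tendsto (fun θ ↦ jumpExponent ν θ / θ ^ 2) atTop (𝓝 0) := by
  have key : Tendsto (fun θ : ℝ ↦ ∫ u, (1 - Real.cos (u * θ)) / θ ^ 2 ∂ν) atTop
      (𝓝 (∫ _, (0 : ℝ) ∂ν)) := by
    refine tendsto_integral_filter_of_dominated_convergence (fun u ↦ 3 * min (u ^ 2) 1) ?_ ?_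
      (h.integrable_min.const_mul _) (ae_of_all _ fun u ↦ ?_)
    · exact Eventually.of_forall fun θ ↦ by fun_prop
    · filter_upwards [eventually_ge_atTop 1] with θ hθ
      refine ae_of_all _ fun u ↦ ?_
      have h0 : 0 ≤ min (u ^ 2) 1 := by positivity
      rw [norm_div, Real.norm_of_nonneg (one_sub_cos_nonneg _), Real.norm_of_nonneg (sq_nonneg θ),
        div_le_iff₀ (by positivity)]
      refine (one_sub_cos_mul_le u θ).trans ?_
      have : 1 ≤ θ ^ 2 := one_le_pow₀ hθ
      nlinarith
    · refine tendsto_of_tendsto_of_tendsto_of_le_of_le' tendsto_const_nhds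
        (h := fun θ : ℝ ↦ 2 / θ ^ 2) ?_ ?_ ?_
      · exact tendsto_const_nhds.div_atTop (tendsto_pow_atTop two_ne_zero)
      · exact Eventually.of_forall fun θ ↦ div_nonneg (one_sub_cos_nonneg _) (sq_nonneg _)
      · exact Eventually.of_forall fun θ ↦ by
          have := one_sub_cos_le_two (u * θ)
          gcongr
  simpa [jumpExponent, integral_div] using key

lemma symTail_eq (ν : Measure ℝ) {θ : ℝ} (hθ : 0 < θ) (t : ℝ) :
    symTail ν (t / θ) = ν.real {u | t ≤ |u * θ|} := by
  unfold symTail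
  congr 1
  ext u
  have : t ≤ |u * θ| ↔ t / θ ≤ |u| := by
    rw [abs_mul, abs_of_pos hθ, div_le_iff₀ hθ]
  simp only [Set.mem_union, Set.mem_Iic, Set.mem_Ici, Set.mem_ofPred_eq]
  rw [this, le_abs, le_neg, or_comm]

lemma IsLevyMeasure.measure_lt_top {ν : Measure ℝ} (h : IsLevyMeasure ν) {θ t : ℝ}
    (hθ : 0 < θ) (ht : 0 < t) : ν {u | t ≤ |u * θ|} < ∞ := by
  have h0 : 0 < min ((t / θ) ^ 2) 1 := by positivity
  refine lt_of_le_of_lt (measure_mono fun u hu ↦ ?_)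
    (h.integrable_min.measure_ge_lt_top h0)
  have : t / θ ≤ |u| := by
    rw [div_le_iff₀ hθ]; simpa [abs_mul, abs_of_pos hθ] using hu
  have h2 : (t / θ) ^ 2 ≤ u ^ 2 := by
    rw [← sq_abs u]; gcongr
  exact min_le_min_right _ h2

lemma IsLevyMeasure.symTail_anti {ν : Measure ℝ} (h : IsLevyMeasure ν) :
    AntitoneOn (symTail ν) (Set.Ioi 0) := by
  intro s hs t ht hst
  have := symTail_eq ν one_pos s
  have h' := symTail_eq ν one_pos t
  rw [div_one] at this h'
  rw [this, h']
  exact measureReal_mono (fun u hu ↦ le_trans hst hu) (h.measure_lt_top one_pos hs).ne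

lemma symTail_nonneg (ν : Measure ℝ) (t : ℝ) : 0 ≤ symTail ν t := measureReal_nonneg

/-- The tail of a Lévy measure is `o(u⁻²)` at the origin. -/
lemma IsLevyMeasure.tendsto_sq_mul_symTail {ν : Measure ℝ} (h : IsLevyMeasure ν) :
    Tendsto (fun u ↦ u ^ 2 * symTail ν u) (𝓝[>] 0) (𝓝 0) := by
  have hset (u : ℝ) : MeasurableSet {v : ℝ | u ≤ |v * 1|} :=
    measurableSet_le (by fun_prop) (by fun_prop)
  have key : Tendsto (fun u : ℝ ↦ ∫ v, {v : ℝ | u ≤ |v * 1|}.indicator (fun _ ↦ u ^ 2) v ∂ν)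
      (𝓝[>] 0) (𝓝 (∫ _, (0 : ℝ) ∂ν)) := by
    refine tendsto_integral_filter_of_dominated_convergence (fun v ↦ min (v ^ 2) 1) ?_ ?_
      h.integrable_min (ae_of_all _ fun v ↦ ?_)
    · exact Eventually.of_forall fun u ↦
        (measurable_const.indicator (hset u)).aestronglyMeasurable
    · filter_upwards [Ioc_mem_nhdsGT one_pos] with u hu
      refine ae_of_all _ fun v ↦ ?_
      by_cases hv : u ≤ |v|
      · have h2 : u ^ 2 ≤ v ^ 2 := by rw [← sq_abs v]; exact pow_le_pow_left₀ hu.1.le hv 2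
        have h3 : u ^ 2 ≤ 1 := pow_le_one₀ hu.1.le hu.2
        simp [Set.indicator, hv, h2, h3]
      · simp [Set.indicator, hv]
        positivity
    · by_cases hv : v = 0
      · refine tendsto_const_nhds.congr' ?_
        filter_upwards [self_mem_nhdsWithin] with u hu
        have : ¬ u ≤ 0 := not_le.2 hu
        simp [hv, this]
      · have h2 : Tendsto (fun u : ℝ ↦ u ^ 2) (𝓝[>] 0) (𝓝 0) := by
          have : Tendsto (fun u : ℝ ↦ u ^ 2) (𝓝 0) (𝓝 (0 ^ 2)) :=
            (continuous_pow 2).tendsto 0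
          simpa using this.mono_left nhdsWithin_le_nhds
        refine squeeze_zero_norm (fun u ↦ ?_) h2
        exact (norm_indicator_le_norm_self _ _).trans_eq (Real.norm_of_nonneg (sq_nonneg u))
  simp only [integral_zero] at key
  refine key.congr' ?_
  filter_upwards [self_mem_nhdsWithin] with u hu
  rw [integral_indicator_const _ (hset u), ← symTail_eq ν one_pos, div_one, smul_eq_mul, mul_comm]

/-- For a Lévy measure the tail cannot be of exact order `u⁻²`. -/
lemma IsLevyMeasure.not_isEquivalent_sq {ν : Measure ℝ} (h : IsLevyMeasure ν) {c : ℝ} (hc : 0 < c)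
    (hK : symTail ν ~[𝓝[>] 0] (fun u ↦ c / u ^ (2 : ℝ))) : False := by
  have h1 : Tendsto (fun u ↦ u ^ 2 * symTail ν u) (𝓝[>] 0) (𝓝 c) := by
    have h2 := (IsEquivalent.refl (u := fun u : ℝ ↦ u ^ 2) (l := 𝓝[>] 0)).mul hK
    refine h2.symm.tendsto_nhds (tendsto_const_nhds.congr' ?_)
    filter_upwards [self_mem_nhdsWithin] with u hu
    have : u ≠ 0 := ne_of_gt hu
    simp only [Pi.mul_apply, Real.rpow_two]
    field_simp
  exact hc.ne (tendsto_nhds_unique h.tendsto_sq_mul_symTail h1)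

/-! ### Truncated layer cake formula and the stable constant -/

lemma measurableSet_abs_mul_lt (θ M : ℝ) : MeasurableSet {u : ℝ | |u * θ| < M} :=
  measurableSet_lt (by fun_prop) (by fun_prop)

lemma aestronglyMeasurable_symTail_div {ν : Measure ℝ} (h : IsLevyMeasure ν) {θ : ℝ} (hθ : 0 < θ)
    (M : ℝ) : AEStronglyMeasurable (fun t ↦ symTail ν (t / θ)) (volume.restrict (Set.Ioc 0 M)) := by
  refine (aemeasurable_restrict_of_antitoneOn measurableSet_Ioc ?_).aestronglyMeasurable
  intro s hs t ht hst
  exact h.symTail_anti (div_pos hs.1 hθ) (div_pos ht.1 hθ) (by gcongr)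

/-- Layer cake formula for `G(|uθ|)` on `{|uθ| < M}`, where `G' = g`, in terms of the tail of the
Lévy measure. -/
lemma IsLevyMeasure.layercake_truncated {ν : Measure ℝ} (h : IsLevyMeasure ν) {θ M : ℝ}
    (hθ : 0 < θ) (hM : 0 < M) {g G : ℝ → ℝ} (hg : Continuous g) (hg0 : ∀ t, 0 ≤ t → 0 ≤ g t)
    (hgt : ∀ t, 0 ≤ t → g t ≤ 2 * t) (hG : ∀ x, 0 ≤ x → ∫ t in 0..x, g t = G x)
    (hGm : Measurable G) :
    IntegrableOn (fun u ↦ G |u * θ|) {u | |u * θ| < M} ν ∧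
    IntegrableOn (fun t ↦ (symTail ν (t / θ) - symTail ν (M / θ)) * g t) (Set.Ioc 0 M) ∧
    ∫ u in {u | |u * θ| < M}, G |u * θ| ∂ν =
      ∫ t in Set.Ioc 0 M, (symTail ν (t / θ) - symTail ν (M / θ)) * g t := by
  set A : Set ℝ := {u | |u * θ| < M} with hA
  have hAm : MeasurableSet A := measurableSet_abs_mul_lt θ M
  have hG0 (x : ℝ) (hx : 0 ≤ x) : 0 ≤ G x := by
    rw [← hG x hx]
    exact intervalIntegral.integral_nonneg hx fun t ht ↦ hg0 t ht.1
  have hG2 (x : ℝ) (hx : 0 ≤ x) : G x ≤ x ^ 2 := by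
    rw [← hG x hx]
    calc ∫ t in 0..x, g t ≤ ∫ t in 0..x, 2 * t :=
          intervalIntegral.integral_mono_on hx (hg.intervalIntegrable _ _)
            ((by fun_prop : Continuous fun t : ℝ ↦ 2 * t).intervalIntegrable _ _)
            fun t ht ↦ hgt t ht.1
      _ = x ^ 2 := by rw [intervalIntegral.integral_const_mul, integral_id]; ring
  have hnn (t : ℝ) (ht : t ∈ Set.Ioc 0 M) :
      0 ≤ (symTail ν (t / θ) - symTail ν (M / θ)) * g t := by
    refine mul_nonneg (sub_nonneg.2 ?_) (hg0 t ht.1.le)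
    exact h.symTail_anti (div_pos ht.1 hθ) (div_pos hM hθ) (by gcongr; exact ht.2)
  have hint : IntegrableOn (fun u ↦ G |u * θ|) A ν := by
    refine ((h.integrable_min.const_mul (θ ^ 2 + M ^ 2)).integrableOn).mono'
      (hGm.comp (by fun_prop : Measurable fun u : ℝ ↦ |u * θ|)).aestronglyMeasurable ?_
    refine (ae_restrict_iff' hAm).2 (ae_of_all _ fun u hu ↦ ?_)
    rw [Real.norm_of_nonneg (hG0 _ (abs_nonneg _))]
    refine (hG2 _ (abs_nonneg _)).trans ?_
    have hu' : |u * θ| < M := hu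
    have h2 : |u * θ| ^ 2 ≤ M ^ 2 := pow_le_pow_left₀ (abs_nonneg _) hu'.le 2
    rw [sq_abs] at h2 ⊢
    rcases le_total (u ^ 2) 1 with h | h
    · rw [min_eq_left h]; nlinarith [sq_nonneg (u * θ), mul_nonneg (sq_nonneg u) (sq_nonneg M)]
    · rw [min_eq_right h]; nlinarith [sq_nonneg (u * θ), sq_nonneg θ]
  have hlc : ∫⁻ u in A, ENNReal.ofReal (G |u * θ|) ∂ν =
      ∫⁻ t in Set.Ioc 0 M,
        ENNReal.ofReal ((symTail ν (t / θ) - symTail ν (M / θ)) * g t) := by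
    have h1 := lintegral_comp_eq_lintegral_meas_le_mul_of_measurable (ν.restrict A)
      (f := fun u ↦ |u * θ|) (g := g) (fun u ↦ abs_nonneg _) (by fun_prop)
      (fun t _ ↦ hg.intervalIntegrable _ _) hg.measurable (fun t ht ↦ hg0 t ht.le)
    simp only [hG _ (abs_nonneg _)] at h1
    rw [h1, ← lintegral_indicator measurableSet_Ioi, ← lintegral_indicator measurableSet_Ioc]
    congr 1 with t
    by_cases ht : 0 < t
    swap
    · simp [Set.indicator, ht]
    have hS : MeasurableSet {u : ℝ | t ≤ |u * θ|} := measurableSet_le (by fun_prop) (by fun_prop)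
    have hSM : MeasurableSet {u : ℝ | M ≤ |u * θ|} := measurableSet_le (by fun_prop) (by fun_prop)
    rw [Set.indicator_of_mem (by exact ht : t ∈ Set.Ioi 0), Measure.restrict_apply hS]
    have hdiff : {u : ℝ | t ≤ |u * θ|} ∩ A = {u : ℝ | t ≤ |u * θ|} \ {u : ℝ | M ≤ |u * θ|} := by
      ext u; simp [hA]
    by_cases htM : t ≤ M
    · rw [Set.indicator_of_mem (by exact ⟨ht, htM⟩), hdiff,
        ENNReal.ofReal_mul' (hg0 t ht.le), symTail_eq ν hθ, symTail_eq ν hθ]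
      congr 1
      have hsub : {u : ℝ | M ≤ |u * θ|} ⊆ {u : ℝ | t ≤ |u * θ|} := fun u hu ↦ htM.trans hu
      rw [measure_sdiff hsub hSM.nullMeasurableSet (h.measure_lt_top hθ hM).ne,
        ENNReal.ofReal_sub _ measureReal_nonneg,
        ofReal_measureReal (h.measure_lt_top hθ ht).ne,
        ofReal_measureReal (h.measure_lt_top hθ hM).ne]
    · have hempty : {u : ℝ | t ≤ |u * θ|} ∩ A = ∅ := by
        ext u
        simp only [hA, Set.mem_inter_iff, Set.mem_ofPred_eq, Set.mem_empty_iff_false, iff_false,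
          not_and, not_lt]
        intro h'
        linarith
      rw [hempty, Set.indicator_of_notMem (by simp [htM])]
      simp
  have hmeas : AEStronglyMeasurable (fun t ↦ (symTail ν (t / θ) - symTail ν (M / θ)) * g t)
      (volume.restrict (Set.Ioc 0 M)) :=
    ((aestronglyMeasurable_symTail_div h hθ M).sub aestronglyMeasurable_const).mul
      hg.aestronglyMeasurable
  have hnn' := (ae_restrict_iff' (μ := volume) (measurableSet_Ioc (a := 0) (b := M))).2
    (ae_of_all _ hnn)
  have hGnn : ∀ᵐ u ∂ν.restrict A, 0 ≤ G |u * θ| := ae_of_all _ fun u ↦ hG0 _ (abs_nonneg _)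
  refine ⟨hint, ⟨hmeas, ?_⟩, ?_⟩
  · rw [hasFiniteIntegral_iff_ofReal hnn', ← hlc, ← hasFiniteIntegral_iff_ofReal hGnn]
    exact hint.2
  · rw [integral_eq_lintegral_of_nonneg_ae hGnn hint.1, integral_eq_lintegral_of_nonneg_ae hnn' hmeas,
      hlc]

/-- Integration by parts against the tail of the Lévy measure, truncated at `|uθ| < M`. -/
lemma IsLevyMeasure.integral_one_sub_cos_truncated {ν : Measure ℝ} (h : IsLevyMeasure ν) {θ M : ℝ}
    (hθ : 0 < θ) (hM : 0 < M) :
    ∫ u in {u | |u * θ| < M}, (1 - Real.cos (u * θ)) ∂ν =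
      ∫ t in Set.Ioc 0 M, (symTail ν (t / θ) - symTail ν (M / θ)) * Real.sin t := by
  -- `sin t` changes sign, so it is written as the difference of `t` and `t - sin t`.
  obtain ⟨i1, j1, e1⟩ := h.layercake_truncated hθ hM (g := fun t ↦ t) (G := fun x ↦ x ^ 2 / 2)
    continuous_id (fun t ht ↦ ht) (fun t ht ↦ by linarith) (fun x _ ↦ by simp) (by fun_prop)
  obtain ⟨i2, j2, e2⟩ := h.layercake_truncated hθ hM (g := fun t ↦ t - Real.sin t)
    (G := fun x ↦ x ^ 2 / 2 - (1 - Real.cos x)) (by fun_prop)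
    (fun t ht ↦ sub_nonneg.2 (Real.sin_le ht))
    (fun t ht ↦ by
      have := Real.sin_le ht
      have h2 := (abs_le.1 (Real.abs_sin_le_abs (x := t))).1
      rw [abs_of_nonneg ht] at h2
      linarith)
    (fun x _ ↦ by
      rw [intervalIntegral.integral_sub (by simp) (by simp)]
      simp) (by fun_prop)
  have e3 := integral_sub i1 i2
  have e4 := integral_sub j1 j2
  rw [e1, e2, ← e4] at e3
  simp only [sub_sub_cancel, Real.cos_abs] at e3
  rw [e3]
  congr 1 with t
  ring

/-! ### The exponent under a power-law tail at the origin -/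

/-- The jumps with `|uθ| ≥ M` contribute at most twice their mass. -/
lemma IsLevyMeasure.abs_jumpExponent_sub_le {ν : Measure ℝ} (h : IsLevyMeasure ν) {θ M : ℝ}
    (hθ : 0 < θ) (hM : 0 < M) :
    |jumpExponent ν θ - ∫ t in Set.Ioc 0 M,
      (symTail ν (t / θ) - symTail ν (M / θ)) * Real.sin t| ≤ 2 * symTail ν (M / θ) := by
  have hcompl : {u : ℝ | |u * θ| < M}ᶜ = {u : ℝ | M ≤ |u * θ|} := by ext u; simp
  have hsplit := integral_add_compl (measurableSet_abs_mul_lt θ M) (h.integrable_one_sub_cos θ)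
  rw [h.integral_one_sub_cos_truncated hθ hM, hcompl] at hsplit
  rw [jumpExponent, ← hsplit, add_sub_cancel_left, symTail_eq ν hθ]
  have := norm_setIntegral_le_of_norm_le_const (μ := ν) (C := 2)
    (f := fun u ↦ 1 - Real.cos (u * θ)) (h.measure_lt_top hθ hM) (fun u _ ↦ by
      rw [Real.norm_of_nonneg (one_sub_cos_nonneg _)]; exact one_sub_cos_le_two _)
  exact this

/-- The measure `α u^(-α-1) du` on the positive half-line, the Lévy measure of a one-sided
`α`-stable process with tail `u^(-α)`. -/
noncomputable def stableLevyMeasure (α : ℝ) : Measure ℝ :=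
  (volume.restrict (Set.Ioi 0)).withDensity fun u ↦ ENNReal.ofReal (α * u ^ (-α - 1))

lemma stableLevyMeasure_tail {α : ℝ} (hα : 0 < α) {u : ℝ} (hu : 0 < u) :
    symTail (stableLevyMeasure α) u = u ^ (-α) := by
  have hS : MeasurableSet (Set.Iic (-u) ∪ Set.Ici u) := measurableSet_Iic.union measurableSet_Ici
  have hinter : (Set.Iic (-u) ∪ Set.Ici u) ∩ Set.Ioi 0 = Set.Ici u := by
    ext v
    simp only [Set.mem_inter_iff, Set.mem_union, Set.mem_Iic, Set.mem_Ici, Set.mem_Ioi]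
    constructor
    · rintro ⟨h | h, h'⟩
      · linarith
      · exact h
    · intro h
      exact ⟨Or.inr h, hu.trans_le h⟩
  have hint : IntegrableOn (fun v : ℝ ↦ α * v ^ (-α - 1)) (Set.Ioi u) :=
    (integrableOn_Ioi_rpow_of_lt (by linarith) hu).const_mul α
  rw [symTail, measureReal_def, stableLevyMeasure, withDensity_apply _ hS,
    Measure.restrict_restrict hS, hinter, Measure.restrict_congr_set Ioi_ae_eq_Ici.symm,
    ← ofReal_integral_eq_lintegral_ofReal hint, ENNReal.toReal_ofReal, integral_const_mul,
    integral_Ioi_rpow_of_lt (by linarith) hu]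
  · simp only [sub_add_cancel]
    field_simp
  · refine setIntegral_nonneg measurableSet_Ioi fun v hv ↦ ?_
    have : 0 < v := hu.trans hv
    positivity
  · refine (ae_restrict_iff' measurableSet_Ioi).2 (ae_of_all _ fun v hv ↦ ?_)
    have : 0 < v := hu.trans hv
    simp only [Pi.zero_apply]
    positivity

lemma isLevyMeasure_stableLevyMeasure {α : ℝ} (hα : 0 < α) (hα2 : α < 2) :
    IsLevyMeasure (stableLevyMeasure α) := by
  have hint : IntegrableOn (fun u : ℝ ↦ α * u ^ (-α - 1) * min (u ^ 2) 1) (Set.Ioi 0) := by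
    rw [← Set.Ioc_union_Ioi_eq_Ioi zero_le_one]
    have hm : Measurable fun u : ℝ ↦ α * u ^ (-α - 1) * min (u ^ 2) 1 := by fun_prop
    refine IntegrableOn.union ?_ ?_
    · have h1 : IntegrableOn (fun u : ℝ ↦ α * u ^ (1 - α)) (Set.Ioc 0 1) :=
        ((intervalIntegrable_iff_integrableOn_Ioc_of_le zero_le_one).1
          (intervalIntegral.intervalIntegrable_rpow' (by linarith))).const_mul α
      refine h1.congr_fun (fun u hu ↦ ?_) measurableSet_Ioc
      have h2 : u ^ 2 ≤ 1 := pow_le_one₀ hu.1.le hu.2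
      simp only [min_eq_left h2, mul_assoc]
      rw [← Real.rpow_natCast u 2, ← Real.rpow_add hu.1]
      congr 2
      push_cast
      ring
    · have h1 : IntegrableOn (fun u : ℝ ↦ α * u ^ (-α - 1)) (Set.Ioi 1) :=
        (integrableOn_Ioi_rpow_of_lt (by linarith) one_pos).const_mul α
      refine h1.congr_fun (fun u hu ↦ ?_) measurableSet_Ioi
      have h2 : 1 ≤ u ^ 2 := one_le_pow₀ (le_of_lt hu)
      simp [min_eq_right h2]
  unfold IsLevyMeasure stableLevyMeasure
  rw [lintegral_withDensity_eq_lintegral_mul _ (by fun_prop) (by fun_prop)]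
  have := hint.2
  rw [hasFiniteIntegral_iff_ofReal] at this
  · refine (lintegral_congr_ae ?_).trans_lt this
    refine (ae_restrict_iff' measurableSet_Ioi).2 (ae_of_all _ fun u hu ↦ ?_)
    have hu' : (0 : ℝ) < u := hu
    simp only [Pi.mul_apply]
    rw [← ENNReal.ofReal_mul (by positivity)]
  · refine (ae_restrict_iff' measurableSet_Ioi).2 (ae_of_all _ fun u hu ↦ ?_)
    have hu' : (0 : ℝ) < u := hu
    simp only [Pi.zero_apply]
    positivity

/-- The constant `∫₀^∞ (1 - cos u) α u^(-α-1) du`. -/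
noncomputable def stableConst (α : ℝ) : ℝ := jumpExponent (stableLevyMeasure α) 1

lemma stableConst_pos {α : ℝ} (hα : 0 < α) (hα2 : α < 2) : 0 < stableConst α := by
  have hL := isLevyMeasure_stableLevyMeasure hα hα2
  refine lt_of_le_of_ne (jumpExponent_nonneg _ _) fun h0 ↦ ?_
  have hae := (integral_eq_zero_iff_of_nonneg (fun u ↦ one_sub_cos_nonneg _)
    (hL.integrable_one_sub_cos 1)).1 h0.symm
  -- `1 - cos` does not vanish on `[1/2, 1)`, which is charged by the stable Lévy measure.
  have hsub : {u : ℝ | 1 / 2 ≤ |u * 1|} \ {u : ℝ | 1 ≤ |u * 1|} ⊆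
      {u : ℝ | ¬ (1 - Real.cos (u * 1)) = 0} := by
    rintro u ⟨h1, h2⟩ h3
    simp only [mul_one, Set.mem_ofPred_eq, not_le] at h1 h2 h3
    have hpi := Real.pi_gt_three
    rw [sub_eq_zero, eq_comm, Real.cos_eq_one_iff_of_lt_of_lt (by linarith [(abs_lt.1 h2).1])
      (by linarith [(abs_lt.1 h2).2])] at h3
    rw [h3, abs_zero] at h1
    norm_num at h1
  have hzero := measure_mono_null hsub hae
  have hsub' : {u : ℝ | 1 ≤ |u * 1|} ⊆ {u : ℝ | 1 / 2 ≤ |u * 1|} :=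
    fun u hu ↦ (by norm_num : (1 : ℝ) / 2 ≤ 1).trans hu
  rw [measure_sdiff hsub'
    (measurableSet_le (by fun_prop) (by fun_prop)).nullMeasurableSet
    (hL.measure_lt_top one_pos one_pos).ne, tsub_eq_zero_iff_le] at hzero
  have h1 := ENNReal.toReal_mono (hL.measure_lt_top one_pos one_pos).ne hzero
  rw [← measureReal_def, ← measureReal_def, ← symTail_eq _ one_pos, ← symTail_eq _ one_pos,
    stableLevyMeasure_tail hα (by norm_num), stableLevyMeasure_tail hα (by norm_num)] at h1
  have h2 : (1 / 1 : ℝ) ^ (-α) < (1 / 2 / 1 : ℝ) ^ (-α) :=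
    Real.rpow_lt_rpow_of_neg (by norm_num) (by norm_num) (by linarith)
  linarith

/-- The truncated version `∫₀^M (t^(-α) - M^(-α)) sin t dt` of `stableConst α`. -/
noncomputable def stableConstTrunc (α M : ℝ) : ℝ :=
  ∫ t in Set.Ioc 0 M, (t ^ (-α) - M ^ (-α)) * Real.sin t

lemma abs_stableConst_sub_le {α M : ℝ} (hα : 0 < α) (hα2 : α < 2) (hM : 0 < M) :
    |stableConst α - stableConstTrunc α M| ≤ 2 * M ^ (-α) := by
  have h := (isLevyMeasure_stableLevyMeasure hα hα2).abs_jumpExponent_sub_le one_pos hM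
  simp only [div_one] at h
  rw [stableLevyMeasure_tail hα hM] at h
  have e : stableConstTrunc α M = ∫ t in Set.Ioc 0 M,
      (symTail (stableLevyMeasure α) t - M ^ (-α)) * Real.sin t :=
    setIntegral_congr_fun measurableSet_Ioc fun t ht ↦ by
      simp only [stableLevyMeasure_tail hα ht.1]
  rw [e]
  exact h

section Tail

variable {ν : Measure ℝ} {α c : ℝ}

lemma tendsto_symTail_div (hK : symTail ν ~[𝓝[>] 0] (fun u ↦ c / u ^ α)) {t : ℝ} (ht : 0 < t) :
    Tendsto (fun θ ↦ symTail ν (t / θ) / θ ^ α) atTop (𝓝 (c * t ^ (-α))) := by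
  have hlim : Tendsto (fun θ : ℝ ↦ t / θ) atTop (𝓝[>] 0) := by
    refine tendsto_nhdsWithin_iff.2 ⟨tendsto_const_nhds.div_atTop tendsto_id, ?_⟩
    filter_upwards [eventually_gt_atTop 0] with θ hθ using div_pos ht hθ
  have h1 := (hK.comp_tendsto hlim).div (IsEquivalent.refl (u := fun θ : ℝ ↦ θ ^ α) (l := atTop))
  refine h1.symm.tendsto_nhds (tendsto_const_nhds.congr' ?_)
  filter_upwards [eventually_gt_atTop 0] with θ hθ
  have h3 : 0 < θ ^ α := by positivity
  have h4 : 0 < t ^ α := by positivity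
  simp only [Function.comp_apply, Pi.div_apply]
  rw [Real.div_rpow ht.le hθ.le, Real.rpow_neg ht.le]
  field_simp

lemma eventually_symTail_le (hc : 0 < c) (hK : symTail ν ~[𝓝[>] 0] (fun u ↦ c / u ^ α)) :
    ∀ᶠ u in 𝓝[>] (0 : ℝ), symTail ν u ≤ 2 * (c / u ^ α) := by
  have h := hK.isLittleO.bound one_pos
  filter_upwards [h, self_mem_nhdsWithin] with u hu hu0
  have hu0' : (0 : ℝ) < u := hu0
  have : 0 < c / u ^ α := by positivity
  simp only [Pi.sub_apply, Real.norm_eq_abs, one_mul, abs_of_pos this] at hu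
  linarith [(abs_le.1 hu).2]

lemma tendsto_truncated_div (h : IsLevyMeasure ν) (hα2 : α < 2) (hc : 0 < c)
    (hK : symTail ν ~[𝓝[>] 0] (fun u ↦ c / u ^ α)) {M : ℝ} (hM : 0 < M) :
    Tendsto (fun θ ↦ (∫ t in Set.Ioc 0 M,
      (symTail ν (t / θ) - symTail ν (M / θ)) * Real.sin t) / θ ^ α) atTop
      (𝓝 (c * stableConstTrunc α M)) := by
  have key : Tendsto (fun θ ↦ ∫ t in Set.Ioc 0 M,
      (symTail ν (t / θ) / θ ^ α - symTail ν (M / θ) / θ ^ α) * Real.sin t) atTop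
      (𝓝 (∫ t in Set.Ioc 0 M, (c * t ^ (-α) - c * M ^ (-α)) * Real.sin t)) := by
    refine tendsto_integral_filter_of_dominated_convergence (fun t ↦ 2 * c * t ^ (1 - α)) ?_ ?_ ?_
      ?_
    · filter_upwards [eventually_gt_atTop 0] with θ hθ
      exact (((aestronglyMeasurable_symTail_div h hθ M).aemeasurable.div_const
        _).aestronglyMeasurable.sub aestronglyMeasurable_const).mul Real.continuous_sin.aestronglyMeasurable
    · obtain ⟨δ, hδ, hδ'⟩ := mem_nhdsGT_iff_exists_Ioo_subset.1 (eventually_symTail_le hc hK)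
      have hδ0 : (0 : ℝ) < δ := hδ
      filter_upwards [eventually_gt_atTop (M / δ), eventually_gt_atTop 0] with θ hθ hθ0
      refine (ae_restrict_iff' measurableSet_Ioc).2 (ae_of_all _ fun t ht ↦ ?_)
      have hmem : t / θ ∈ Set.Ioo 0 δ := by
        refine ⟨div_pos ht.1 hθ0, ?_⟩
        rw [div_lt_iff₀ hδ0] at hθ
        rw [div_lt_iff₀ hθ0]
        linarith [ht.2]
      have h1 : symTail ν (t / θ) ≤ 2 * (c / (t / θ) ^ α) := hδ' hmem
      have h2 : symTail ν (M / θ) ≤ symTail ν (t / θ) :=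
        h.symTail_anti (div_pos ht.1 hθ0) (div_pos hM hθ0) (by gcongr; exact ht.2)
      have h3 := symTail_nonneg ν (M / θ)
      have hθα : 0 < θ ^ α := by positivity
      have htα : 0 < t ^ α := Real.rpow_pos_of_pos ht.1 _
      have h4 : symTail ν (t / θ) / θ ^ α ≤ 2 * c * t ^ (-α) := by
        rw [div_le_iff₀ hθα]
        refine h1.trans_eq ?_
        rw [Real.div_rpow ht.1.le hθ0.le, Real.rpow_neg ht.1.le]
        field_simp
      have h5 : |symTail ν (t / θ) / θ ^ α - symTail ν (M / θ) / θ ^ α| ≤ 2 * c * t ^ (-α) := by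
        rw [← sub_div, abs_of_nonneg (div_nonneg (sub_nonneg.2 h2) hθα.le)]
        refine le_trans ?_ h4
        gcongr
        linarith
      have h6 : |Real.sin t| ≤ t := by
        simpa [abs_of_pos ht.1] using Real.abs_sin_le_abs (x := t)
      rw [norm_mul, Real.norm_eq_abs, Real.norm_eq_abs]
      calc _ ≤ 2 * c * t ^ (-α) * t := by
            have : 0 ≤ 2 * c * t ^ (-α) := (abs_nonneg _).trans h5
            gcongr
        _ = 2 * c * t ^ (1 - α) := by
            rw [mul_assoc, ← Real.rpow_add_one ht.1.ne']
            congr 2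
            ring
    · exact ((intervalIntegrable_iff_integrableOn_Ioc_of_le hM.le).1
          (intervalIntegral.intervalIntegrable_rpow' (by linarith))).const_mul _
    · refine (ae_restrict_iff' measurableSet_Ioc).2 (ae_of_all _ fun t ht ↦ ?_)
      exact ((tendsto_symTail_div hK ht.1).sub (tendsto_symTail_div hK hM)).mul_const _
  have hlim : ∫ t in Set.Ioc 0 M, (c * t ^ (-α) - c * M ^ (-α)) * Real.sin t =
      c * stableConstTrunc α M := by
    rw [stableConstTrunc, ← integral_const_mul]
    congr 1 with t
    ring
  rw [hlim] at key
  refine key.congr fun θ ↦ ?_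
  rw [← integral_div]
  congr 1 with t
  ring

/-- A Tauberian statement: a tail of exact order `c u^(-α)` at the origin gives an exponent of
exact order `c θ^α` at infinity. -/
lemma IsLevyMeasure.tendsto_jumpExponent_div_rpow (h : IsLevyMeasure ν) (hα : 0 < α) (hα2 : α < 2)
    (hc : 0 < c) (hK : symTail ν ~[𝓝[>] 0] (fun u ↦ c / u ^ α)) :
    Tendsto (fun θ ↦ jumpExponent ν θ / θ ^ α) atTop (𝓝 (c * stableConst α)) := by
  rw [Metric.tendsto_nhds]
  intro ε hε
  have hMlim : Tendsto (fun M : ℝ ↦ 4 * c * M ^ (-α)) atTop (𝓝 (4 * c * 0)) :=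
    (tendsto_rpow_neg_atTop hα).const_mul _
  rw [mul_zero] at hMlim
  obtain ⟨M, hMε, hM⟩ := ((hMlim.eventually_lt_const hε).and (eventually_gt_atTop 0)).exists
  have h1 := tendsto_truncated_div h hα2 hc hK hM
  have h2 := (tendsto_symTail_div hK hM).const_mul 2
  have h3 : Tendsto (fun θ ↦ 2 * (symTail ν (M / θ) / θ ^ α) +
      |(∫ t in Set.Ioc 0 M, (symTail ν (t / θ) - symTail ν (M / θ)) * Real.sin t) / θ ^ α -
        c * stableConst α|) atTop
      (𝓝 (2 * (c * M ^ (-α)) + |c * stableConstTrunc α M - c * stableConst α|)) :=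
    h2.add (h1.sub_const _).abs
  have h4 : 2 * (c * M ^ (-α)) + |c * stableConstTrunc α M - c * stableConst α| < ε := by
    rw [← mul_sub, abs_mul, abs_of_pos hc, abs_sub_comm]
    have := mul_le_mul_of_nonneg_left (abs_stableConst_sub_le hα hα2 hM) hc.le
    linarith
  filter_upwards [h3.eventually_lt_const h4, eventually_gt_atTop 0] with θ hθ hθ0
  refine lt_of_le_of_lt ?_ hθ
  have hθα : 0 < θ ^ α := by positivity
  rw [Real.dist_eq]
  refine (abs_sub_le _ ((∫ t in Set.Ioc 0 M,
    (symTail ν (t / θ) - symTail ν (M / θ)) * Real.sin t) / θ ^ α) _).trans ?_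
  gcongr
  rw [← sub_div, abs_div, abs_of_pos hθα, ← mul_div_assoc]
  gcongr
  exact h.abs_jumpExponent_sub_le hθ0 hM

end Tail

/-! ### Weak convergence and characteristic functions -/

/-- Lévy's convergence theorem along a countably generated filter. -/
lemma tendsto_probabilityMeasure_of_charFun {ι : Type*} {l : Filter ι} [l.IsCountablyGenerated]
    {μ : ι → ProbabilityMeasure ℝ} {μ₀ : ProbabilityMeasure ℝ}
    (h : ∀ θ : ℝ, Tendsto (fun i ↦ charFun (μ i : Measure ℝ) θ) l
      (𝓝 (charFun (μ₀ : Measure ℝ) θ))) : Tendsto μ l (𝓝 μ₀) :=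
  tendsto_of_seq_tendsto fun _ hu ↦
    ProbabilityMeasure.tendsto_of_tendsto_charFun fun θ ↦ (h θ).comp hu

/-- The part of Lévy's convergence theorem that produces the limit law. -/
lemma exists_charFun_eq_of_tendsto {μ : ℕ → ProbabilityMeasure ℝ} {f : ℝ → ℂ}
    (hf : ContinuousAt f 0)
    (h : ∀ θ : ℝ, Tendsto (fun n ↦ charFun (μ n : Measure ℝ) θ) atTop (𝓝 (f θ))) :
    ∃ S : ProbabilityMeasure ℝ, ∀ θ, charFun (S : Measure ℝ) θ = f θ := by
  have htight := isTightMeasureSet_of_tendsto_charFun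
    (μ := fun n ↦ (μ n : Measure ℝ)) hf h
  have hcomp : IsCompact (closure (Set.range μ)) := by
    refine isCompact_closure_of_isTightMeasureSet ?_
    convert htight
    ext ν
    simp
  obtain ⟨S, -, φ, hφ, hlim⟩ := hcomp.tendsto_subseq
    (fun n ↦ subset_closure (Set.mem_range_self n))
  refine ⟨S, fun θ ↦ ?_⟩
  exact tendsto_nhds_unique (ProbabilityMeasure.tendsto_iff_tendsto_charFun.1 hlim θ)
    ((h θ).comp hφ.tendsto_atTop)

/-- Fubini's theorem for characteristic functions. -/
lemma integral_charFun_comm (μ ν : Measure ℝ) [IsProbabilityMeasure μ] [IsProbabilityMeasure ν] :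
    ∫ x, charFun μ x ∂ν = ∫ x, charFun ν x ∂μ := by
  simp only [charFun_apply_real]
  rw [integral_integral_swap]
  · congr 1 with x
    congr 1 with y
    rw [mul_comm (x : ℂ)]
  · refine Integrable.mono' (integrable_const 1) (by fun_prop) (ae_of_all _ fun p ↦ ?_)
    simp only [Function.uncurry]
    rw [← Complex.ofReal_mul, Complex.norm_exp_ofReal_mul_I]

/-- A stable law has no atom at the origin. -/
lemma IsStdStable.measure_singleton_zero {α : ℝ} (hα : 0 < α) {S : Measure ℝ}
    [IsProbabilityMeasure S] (hS : IsStdStable α S) : S {0} = 0 := by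
  -- Smooth the indicator of the origin by Gaussian characteristic functions of growing variance.
  have h1 : Tendsto (fun n : ℕ ↦ ∫ x, charFun (gaussianReal 0 ((n : ℝ≥0) ^ 2)) x ∂S) atTop
      (𝓝 (∫ x, ({0} : Set ℝ).indicator (fun _ ↦ (1 : ℂ)) x ∂S)) := by
    refine tendsto_integral_of_dominated_convergence (fun _ ↦ (1 : ℝ))
      (fun n ↦ (measurable_charFun).aestronglyMeasurable)
      (integrable_const _) (fun n ↦ ae_of_all _ fun x ↦ norm_charFun_le_one x)
      (ae_of_all _ fun x ↦ ?_)
    simp only [charFun_gaussianReal]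
    by_cases hx : x = 0
    · simp [hx]
    · have h2 : Tendsto (fun n : ℕ ↦ -(((n : ℝ) ^ 2) * (x ^ 2 / 2))) atTop atBot :=
        tendsto_neg_atTop_atBot.comp (((tendsto_pow_atTop two_ne_zero).comp
          tendsto_natCast_atTop_atTop).atTop_mul_const (by positivity))
      have h3 := (Complex.continuous_ofReal.tendsto 0).comp (Real.tendsto_exp_atBot.comp h2)
      simp only [Complex.ofReal_zero] at h3
      simp only [Set.indicator, Set.mem_singleton_iff, hx, if_false]
      refine h3.congr fun n ↦ ?_
      simp only [Function.comp_apply]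
      push_cast
      congr 1
      ring
  have h2 : Tendsto (fun n : ℕ ↦ ∫ x, charFun S ((n : ℝ) * x) ∂(gaussianReal 0 1)) atTop
      (𝓝 (∫ _, (0 : ℂ) ∂(gaussianReal 0 1))) := by
    refine tendsto_integral_of_dominated_convergence (fun _ ↦ (1 : ℝ))
      (fun n ↦ (measurable_charFun.comp (measurable_const_mul _)).aestronglyMeasurable)
      (integrable_const _) (fun n ↦ ae_of_all _ fun x ↦ norm_charFun_le_one _) ?_
    have : NullSingletonClass (gaussianReal 0 1) := nullSingletonClass_gaussianReal one_ne_zero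
    have hne : ∀ᵐ x ∂(gaussianReal 0 1), x ≠ 0 := by simp [ae_iff]
    filter_upwards [hne] with x hx
    have h3 : Tendsto (fun n : ℕ ↦ -|(n : ℝ) * x| ^ α) atTop atBot := by
      refine tendsto_neg_atTop_atBot.comp ((tendsto_rpow_atTop hα).comp ?_)
      simp only [abs_mul, Nat.abs_cast]
      exact tendsto_natCast_atTop_atTop.atTop_mul_const (abs_pos.2 hx)
    have h4 := (Complex.continuous_ofReal.tendsto 0).comp (Real.tendsto_exp_atBot.comp h3)
    simp only [Complex.ofReal_zero] at h4
    refine h4.congr fun n ↦ ?_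
    rw [hS]
    simp
  have h3 (n : ℕ) : ∫ x, charFun (gaussianReal 0 ((n : ℝ≥0) ^ 2)) x ∂S =
      ∫ x, charFun S ((n : ℝ) * x) ∂(gaussianReal 0 1) := by
    rw [integral_charFun_comm]
    have hmap : gaussianReal 0 ((n : ℝ≥0) ^ 2) = (gaussianReal 0 1).map ((n : ℝ) * ·) := by
      rw [gaussianReal_map_const_mul]
      congr 1
      · simp
      · ext; simp
    rw [hmap, integral_map (by fun_prop) measurable_charFun.aestronglyMeasurable]
  simp only [h3] at h1
  have h4 := tendsto_nhds_unique h1 h2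
  rw [integral_indicator (measurableSet_singleton 0)] at h4
  simpa [measureReal_def, ENNReal.toReal_eq_zero_iff] using h4

/-! ### Small time behaviour of symmetrized Lévy increments -/

lemma charFun_map_sub_eq_norm_sq {Ω : Type*} [MeasurableSpace Ω] {P : Measure Ω}
    [IsProbabilityMeasure P] {U V : Ω → ℝ} (hU : AEMeasurable U P) (hV : AEMeasurable V P)
    (hUV : IndepFun U V P) {θ : ℝ} {φ : ℂ} (h1 : charFun (P.map U) θ = φ)
    (h2 : charFun (P.map V) θ = φ) :
    charFun (P.map (fun ω ↦ U ω - V ω)) θ = ((‖φ‖ ^ 2 : ℝ) : ℂ) := by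
  have hind : IndepFun U (fun ω ↦ -1 * V ω) P := hUV.comp measurable_id (measurable_const_mul (-1))
  have h3 : (fun ω ↦ U ω - V ω) = fun ω ↦ U ω + -1 * V ω := by ext; ring
  rw [h3, hind.charFun_map_fun_add_eq_mul hU (by fun_prop), Pi.mul_apply, charFun_map_mul_comp hV,
    neg_one_mul, charFun_neg, h1, h2, Complex.mul_conj, Complex.normSq_eq_norm_sq]

lemma norm_exp_levyExponent {a γ : ℝ} {ν : Measure ℝ} (h : IsLevyMeasure ν) (t : ℝ) (θ : ℝ) :
    ‖Complex.exp (t * levyExponent a γ ν θ)‖ ^ 2 = Real.exp (-(2 * t * symExponent a ν θ)) := by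
  rw [Complex.norm_exp, Complex.re_ofReal_mul, re_levyExponent h, ← Real.exp_nat_mul]
  congr 1
  push_cast
  ring

/-- `q = symExponent a ν` satisfies `2 q(θ) ~ (cθ)^α` at infinity: the symmetrized process is in
the small time domain of attraction of `c Z_α`. -/
def HasStableGrowth (a : ℝ) (ν : Measure ℝ) (α c : ℝ) : Prop :=
  Tendsto (fun θ ↦ 2 * symExponent a ν θ / θ ^ α) atTop (𝓝 (c ^ α))

lemma HasStableGrowth.tendsto_exp {a : ℝ} {ν : Measure ℝ} {α c : ℝ} (hα : 0 < α) (hc : 0 < c)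
    (h : HasStableGrowth a ν α c) (θ : ℝ) :
    Tendsto (fun t : ℝ ↦ Real.exp (-(2 * t * symExponent a ν (t ^ (-(1 / α)) * θ)))) (𝓝[>] 0)
      (𝓝 (Real.exp (-|c * θ| ^ α))) := by
  refine (Real.continuous_exp.tendsto _).comp ?_
  by_cases hθ : θ = 0
  · simp [hθ, symExponent, jumpExponent, Real.zero_rpow hα.ne']
  have hθ' : 0 < |θ| := abs_pos.2 hθ
  have hs : Tendsto (fun t : ℝ ↦ t ^ (-(1 / α)) * |θ|) (𝓝[>] 0) atTop := by
    refine Tendsto.atTop_mul_const hθ' ?_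
    exact tendsto_rpow_neg_nhdsGT_zero (by simpa using hα)
  have h1 := (h.comp hs).mul_const (-|θ| ^ α)
  have h2 : c ^ α * -|θ| ^ α = -|c * θ| ^ α := by
    rw [abs_mul, abs_of_pos hc, Real.mul_rpow hc.le hθ'.le]; ring
  rw [h2] at h1
  refine h1.congr' ?_
  filter_upwards [self_mem_nhdsWithin] with t ht
  have ht0 : (0 : ℝ) < t := ht
  have habs : |t ^ (-(1 / α)) * θ| = t ^ (-(1 / α)) * |θ| := by
    rw [abs_mul, abs_of_pos (by positivity)]
  simp only [Function.comp_apply]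
  rw [← symExponent_abs a ν (_ * θ), habs, Real.mul_rpow (by positivity) hθ'.le,
    ← Real.rpow_mul ht0.le]
  have h3 : -(1 / α) * α = -1 := by field_simp
  rw [h3, Real.rpow_neg_one]
  have h4 : 0 < |θ| ^ α := by positivity
  field_simp

/-- Weak convergence to `c Z_α` of rescaled symmetric variables with exponent `2 t q`. -/
lemma HasStableGrowth.tendsto_map {a : ℝ} {ν : Measure ℝ} {α c : ℝ} (hα : 0 < α) (hc : 0 < c)
    (h : HasStableGrowth a ν α c) {S : ProbabilityMeasure ℝ} (hS : IsStdStable α (S : Measure ℝ))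
    {ι : Type*} {l : Filter ι} [l.IsCountablyGenerated] {τ : ι → ℝ} (hτ : Tendsto τ l (𝓝[>] 0))
    {μ : ι → ProbabilityMeasure ℝ}
    (hμ : ∀ᶠ i in l, ∀ θ, charFun (μ i : Measure ℝ) θ =
      (Real.exp (-(2 * τ i * symExponent a ν (τ i ^ (-(1 / α)) * θ))) : ℝ)) :
    Tendsto μ l (𝓝 (S.map (f := (c * ·)) (by fun_prop))) := by
  refine tendsto_probabilityMeasure_of_charFun fun θ ↦ ?_
  have h1 : charFun ((S.map (f := (c * ·)) (by fun_prop) : ProbabilityMeasure ℝ) : Measure ℝ) θ =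
      (Real.exp (-|c * θ| ^ α) : ℝ) := by
    rw [ProbabilityMeasure.toMeasure_map, charFun_map_mul, hS]
    simp
  rw [h1]
  refine ((Complex.continuous_ofReal.tendsto _).comp ((h.tendsto_exp hα hc θ).comp hτ)).congr' ?_
  filter_upwards [hμ] with i hi
  rw [hi]
  rfl

/-! ### The function `psi` and weak convergence -/

lemma psi_nonneg (x y : ℝ) : 0 ≤ psi x y := by
  unfold psi
  split_ifs <;> positivity

lemma psi_le_one (x y : ℝ) : psi x y ≤ 1 := by
  unfold psi
  split_ifs
  · exact le_rfl
  · exact div_le_one_of_le₀ (abs_add_le x y) (by positivity)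

lemma abs_psi_le_one (x y : ℝ) : |psi x y| ≤ 1 := by
  rw [abs_of_nonneg (psi_nonneg x y)]
  exact psi_le_one x y

lemma psi_mul_mul {b : ℝ} (hb : b ≠ 0) (x y : ℝ) : psi (b * x) (b * y) = psi x y := by
  have hb' : |b| ≠ 0 := abs_ne_zero.2 hb
  unfold psi
  simp only [mul_eq_zero, hb, false_or, ← mul_add, abs_mul]
  rw [mul_div_mul_left _ _ hb']

lemma measurable_psi : Measurable fun p : ℝ × ℝ ↦ psi p.1 p.2 := by
  unfold psi
  refine Measurable.ite ?_ (by fun_prop) (by fun_prop)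
  exact (measurableSet_eq_fun measurable_fst measurable_const).inter
    (measurableSet_eq_fun measurable_snd measurable_const)

@[fun_prop]
lemma _root_.Measurable.psi {α : Type*} [MeasurableSpace α] {f g : α → ℝ}
    (hf : Measurable f) (hg : Measurable g) : Measurable fun x ↦ psi (f x) (g x) :=
  measurable_psi.comp (hf.prodMk hg)

lemma continuousAt_psi {p : ℝ × ℝ} (hp : p ≠ 0) :
    ContinuousAt (fun p : ℝ × ℝ ↦ psi p.1 p.2) p := by
  have h1 : (fun q : ℝ × ℝ ↦ |q.1 + q.2| / (|q.1| + |q.2|)) =ᶠ[𝓝 p]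
      fun p : ℝ × ℝ ↦ psi p.1 p.2 := by
    filter_upwards [isOpen_ne.mem_nhds hp] with q hq
    have : ¬ (q.1 = 0 ∧ q.2 = 0) := fun h ↦ hq (Prod.ext h.1 h.2)
    simp [psi, this]
  refine ContinuousAt.congr ?_ h1
  refine ContinuousAt.div (by fun_prop) (by fun_prop) fun h ↦ hp ?_
  have h2 := abs_nonneg p.1
  have h3 := abs_nonneg p.2
  exact Prod.ext (abs_eq_zero.1 (by linarith)) (abs_eq_zero.1 (by linarith))

/-- A mapping theorem: expectations of a bounded function converge under weak convergence when its
discontinuities lie in the zero set of a continuous function, a null set for the limit law. -/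
lemma tendsto_integral_of_continuousAt {E : Type*} [TopologicalSpace E] [MeasurableSpace E]
    [OpensMeasurableSpace E] {ι : Type*} {l : Filter ι} {μ : ι → ProbabilityMeasure E}
    {μ₀ : ProbabilityMeasure E} (h : Tendsto μ l (𝓝 μ₀)) {F f : E → ℝ} (hF : Measurable F)
    (hF1 : ∀ z, |F z| ≤ 1) (hf : Continuous f) (hFc : ∀ z, f z ≠ 0 → ContinuousAt F z)
    (h0 : (μ₀ : Measure E) {z | f z = 0} = 0) :
    Tendsto (fun i ↦ ∫ z, F z ∂(μ i : Measure E)) l (𝓝 (∫ z, F z ∂(μ₀ : Measure E))) := by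
  -- The cutoff `g n` vanishes on the zero set of `f` and tends to one outside of it.
  let g : ℕ → E → ℝ := fun n z ↦ min (n * |f z|) 1
  have hg0 (n z) : 0 ≤ g n z := by positivity
  have hg1 (n z) : g n z ≤ 1 := min_le_right _ _
  have hgc (n) : Continuous (g n) := by fun_prop
  have hFg (n) : Continuous fun z ↦ F z * g n z := by
    refine continuous_iff_continuousAt.2 fun z ↦ ?_
    by_cases hz : f z = 0
    · have hgz : g n z = 0 := by simp [g, hz]
      have h1 : Tendsto (g n) (𝓝 z) (𝓝 0) := by
        have := (hgc n).tendsto z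
        rwa [hgz] at this
      rw [ContinuousAt, hgz, mul_zero]
      refine squeeze_zero_norm (fun y ↦ ?_) h1
      rw [norm_mul, Real.norm_eq_abs, Real.norm_of_nonneg (hg0 n y)]
      exact mul_le_of_le_one_left (hg0 n y) (hF1 y)
    · exact (hFc z hz).mul (hgc n).continuousAt
  have hFgb (n z) : |F z * g n z| ≤ 1 := by
    rw [abs_mul, abs_of_nonneg (hg0 n z)]
    exact mul_le_one₀ (hF1 z) (hg0 n z) (hg1 n z)
  have hint (ρ : ProbabilityMeasure E) {G : E → ℝ} (hG : Measurable G) (hG1 : ∀ z, |G z| ≤ 1) :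
      Integrable G (ρ : Measure E) :=
    (integrable_const (1 : ℝ)).mono' hG.aestronglyMeasurable (ae_of_all _ hG1)
  have hlim (G : E → ℝ) (hG : Continuous G) (hG1 : ∀ z, |G z| ≤ 1) :
      Tendsto (fun i ↦ ∫ z, G z ∂(μ i : Measure E)) l (𝓝 (∫ z, G z ∂(μ₀ : Measure E))) := by
    have := (ProbabilityMeasure.tendsto_iff_forall_integral_tendsto.1 h)
      (BoundedContinuousFunction.ofNormedAddCommGroup G hG 1 hG1)
    simpa using this
  have herr (ρ : ProbabilityMeasure E) (n) :
      |∫ z, F z ∂(ρ : Measure E) - ∫ z, F z * g n z ∂(ρ : Measure E)| ≤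
        ∫ z, (1 - g n z) ∂(ρ : Measure E) := by
    rw [← integral_sub (hint ρ hF hF1) (hint ρ (hFg n).measurable (hFgb n))]
    refine (abs_integral_le_integral_abs).trans ?_
    have hi : Integrable (fun z ↦ 1 - g n z) (ρ : Measure E) :=
      hint ρ (by fun_prop) fun z ↦ by
        rw [abs_of_nonneg (sub_nonneg.2 (hg1 n z))]; linarith [hg0 n z]
    refine integral_mono_of_nonneg (ae_of_all _ fun z ↦ abs_nonneg _) hi (ae_of_all _ fun z ↦ ?_)
    have h2 : F z - F z * g n z = F z * (1 - g n z) := by ring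
    simp only [h2, abs_mul, abs_of_nonneg (sub_nonneg.2 (hg1 n z))]
    exact mul_le_of_le_one_left (sub_nonneg.2 (hg1 n z)) (hF1 z)
  have hcut : Tendsto (fun n ↦ ∫ z, (1 - g n z) ∂(μ₀ : Measure E)) atTop (𝓝 0) := by
    have : Tendsto (fun n ↦ ∫ z, (1 - g n z) ∂(μ₀ : Measure E)) atTop
        (𝓝 (∫ _, (0 : ℝ) ∂(μ₀ : Measure E))) := by
      refine tendsto_integral_of_dominated_convergence (fun _ ↦ (1 : ℝ))
        (fun n ↦ (by fun_prop : Measurable fun z ↦ 1 - g n z).aestronglyMeasurable)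
        (integrable_const _) (fun n ↦ ae_of_all _ fun z ↦ ?_) ?_
      · rw [Real.norm_of_nonneg (sub_nonneg.2 (hg1 n z))]; linarith [hg0 n z]
      · have hne : ∀ᵐ z ∂(μ₀ : Measure E), f z ≠ 0 := by
          rw [ae_iff]; simpa using h0
        filter_upwards [hne] with z hz
        have hz' : 0 < |f z| := abs_pos.2 hz
        have h3 : Tendsto (fun n : ℕ ↦ (n : ℝ) * |f z|) atTop atTop :=
          tendsto_natCast_atTop_atTop.atTop_mul_const hz'
        refine tendsto_const_nhds.congr' ?_
        filter_upwards [h3.eventually_ge_atTop 1] with n hn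
        simp [g, min_eq_right hn]
    simpa using this
  rw [Metric.tendsto_nhds]
  intro ε hε
  obtain ⟨n, hn⟩ := (hcut.eventually_lt_const (by positivity : 0 < ε / 4)).exists
  have h1 := Metric.tendsto_nhds.1 (hlim _ (hFg n) (hFgb n)) (ε / 4) (by positivity)
  have h2 := (hlim (fun z ↦ 1 - g n z) (by fun_prop) (fun z ↦ by
    rw [abs_of_nonneg (sub_nonneg.2 (hg1 n z))]; linarith [hg0 n z])).eventually_lt_const hn
  filter_upwards [h1, h2] with i hi1 hi2
  have e1 := herr (μ i) n
  have e2 := herr μ₀ n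
  rw [Real.dist_eq] at hi1 ⊢
  rw [abs_lt] at hi1 ⊢
  rw [abs_le] at e1 e2
  constructor <;> linarith [hi1.1, hi1.2, e1.1, e1.2, e2.1, e2.2]

instance isProbabilityMeasure_threeCopies (S : Measure ℝ) [IsProbabilityMeasure S] :
    IsProbabilityMeasure (threeCopies S) := by
  unfold threeCopies; infer_instance

lemma threeCopies_map_mul (S : Measure ℝ) [IsProbabilityMeasure S] (b : ℝ) :
    threeCopies (S.map (b * ·)) = (threeCopies S).map fun z i ↦ b * z i := by
  have : IsProbabilityMeasure (S.map (b * ·)) :=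
    Measure.isProbabilityMeasure_map (by fun_prop)
  unfold threeCopies
  rw [Measure.pi_map_pi (fun _ ↦ by fun_prop)]

/-- Expectations of scale invariant functions of three independent copies converge when the laws
converge after rescaling. -/
lemma tendsto_integral_threeCopies {ι : Type*} {l : Filter ι} {μ : ι → ProbabilityMeasure ℝ}
    {S : ProbabilityMeasure ℝ} {b : ι → ℝ} {c : ℝ} (hb : ∀ᶠ i in l, b i ≠ 0) (hc : c ≠ 0)
    (h : Tendsto (fun i ↦ (μ i).map (f := (b i * ·)) (by fun_prop)) l
      (𝓝 (S.map (f := (c * ·)) (by fun_prop))))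
    (hS : (S : Measure ℝ) {0} = 0) {F : (Fin 3 → ℝ) → ℝ} (hF : Measurable F)
    (hF1 : ∀ z, |F z| ≤ 1) (hFc : ∀ z, z 1 ≠ 0 → ContinuousAt F z)
    (hFs : ∀ b : ℝ, b ≠ 0 → ∀ z, (F fun i ↦ b * z i) = F z) :
    Tendsto (fun i ↦ ∫ z, F z ∂(threeCopies (μ i : Measure ℝ))) l
      (𝓝 (∫ z, F z ∂(threeCopies (S : Measure ℝ)))) := by
  have hscale (ρ : ProbabilityMeasure ℝ) {b : ℝ} (hb : b ≠ 0) :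
      ∫ z, F z ∂(ProbabilityMeasure.pi fun _ : Fin 3 ↦
        ρ.map (f := (b * ·)) (by fun_prop) : ProbabilityMeasure (Fin 3 → ℝ)) =
      ∫ z, F z ∂(threeCopies (ρ : Measure ℝ)) := by
    have h1 : ((ProbabilityMeasure.pi fun _ : Fin 3 ↦
        ρ.map (f := (b * ·)) (by fun_prop) : ProbabilityMeasure (Fin 3 → ℝ)) :
        Measure (Fin 3 → ℝ)) = threeCopies ((ρ : Measure ℝ).map (b * ·)) := rfl
    rw [h1, threeCopies_map_mul, integral_map (measurable_pi_lambda _ fun i ↦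
      (measurable_pi_apply i).const_mul b).aemeasurable hF.aestronglyMeasurable]
    simp [hFs b hb]
  have hpi : Tendsto (fun i ↦ ProbabilityMeasure.pi fun _ : Fin 3 ↦
      (μ i).map (f := (b i * ·)) (by fun_prop)) l
      (𝓝 (ProbabilityMeasure.pi fun _ : Fin 3 ↦ S.map (f := (c * ·)) (by fun_prop))) :=
    (ProbabilityMeasure.continuous_pi.tendsto _).comp (tendsto_pi_nhds.2 fun _ ↦ h)
  have hnull : ((ProbabilityMeasure.pi fun _ : Fin 3 ↦ S.map (f := (c * ·)) (by fun_prop) :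
      ProbabilityMeasure (Fin 3 → ℝ)) : Measure (Fin 3 → ℝ)) {z | z 1 = 0} = 0 := by
    have h2 := (measurePreserving_eval
      (fun _ : Fin 3 ↦ ((S.map (f := (c * ·)) (by fun_prop) : ProbabilityMeasure ℝ) :
        Measure ℝ)) 1).measure_preimage (measurableSet_singleton (0 : ℝ)).nullMeasurableSet
    rw [ProbabilityMeasure.toMeasure_map,
      Measure.map_apply (by fun_prop) (measurableSet_singleton _)] at h2
    have h3 : (c * · : ℝ → ℝ) ⁻¹' {0} = {0} := by ext; simp [hc]
    rw [h3, hS] at h2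
    exact h2
  have key := tendsto_integral_of_continuousAt hpi hF hF1 (continuous_apply 1) hFc hnull
  rw [hscale S hc] at key
  refine key.congr' ?_
  filter_upwards [hb] with i hi
  exact hscale (μ i) hi

/-- The variance of `psi` at two independent variables of law `S`. -/
noncomputable def psiVar (S : Measure ℝ) : ℝ :=
  variance (fun z ↦ psi (z 0) (z 1)) (threeCopies S)

/-- The covariance of `psi (Z₁, Z₂)` and `psi (Z₂, Z₃)` at three independent variables of law `S`. -/
noncomputable def psiCov (S : Measure ℝ) : ℝ :=
  covariance (fun z ↦ psi (z 0) (z 1)) (fun z ↦ psi (z 1) (z 2)) (threeCopies S)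

lemma memLp_psi {Ω : Type*} [MeasurableSpace Ω] {P : Measure Ω} [IsFiniteMeasure P] {U V : Ω → ℝ}
    (hU : Measurable U) (hV : Measurable V) : MemLp (fun ω ↦ psi (U ω) (V ω)) 2 P :=
  MemLp.of_bound (hU.psi hV).aestronglyMeasurable 1 (ae_of_all _ fun _ ↦ abs_psi_le_one _ _)

lemma continuousAt_psi_apply {i j : Fin 3} {z : Fin 3 → ℝ} (hz : z i ≠ 0 ∨ z j ≠ 0) :
    ContinuousAt (fun z : Fin 3 → ℝ ↦ psi (z i) (z j)) z := by
  have h1 : ContinuousAt (fun p : ℝ × ℝ ↦ psi p.1 p.2) (z i, z j) :=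
    continuousAt_psi fun h ↦ by
      rw [Prod.mk_eq_zero] at h
      tauto
  exact h1.comp (f := fun z : Fin 3 → ℝ ↦ (z i, z j)) (by fun_prop)

section Limits

variable {ι : Type*} {l : Filter ι} {μ : ι → ProbabilityMeasure ℝ}
  {S : ProbabilityMeasure ℝ} {b : ι → ℝ} {c : ℝ}

lemma tendsto_limitMean (hb : ∀ᶠ i in l, b i ≠ 0) (hc : c ≠ 0)
    (h : Tendsto (fun i ↦ (μ i).map (f := (b i * ·)) (by fun_prop)) l
      (𝓝 (S.map (f := (c * ·)) (by fun_prop)))) (hS : (S : Measure ℝ) {0} = 0) :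
    Tendsto (fun i ↦ limitMean (μ i : Measure ℝ)) l (𝓝 (limitMean (S : Measure ℝ))) :=
  tendsto_integral_threeCopies hb hc h hS (by fun_prop) (fun _ ↦ abs_psi_le_one _ _)
    (fun _ hz ↦ continuousAt_psi_apply (Or.inr hz)) fun _ hb _ ↦ psi_mul_mul hb _ _

lemma psiVar_eq (S : Measure ℝ) [IsProbabilityMeasure S] :
    psiVar S = ∫ z, psi (z 0) (z 1) ^ 2 ∂(threeCopies S) - limitMean S ^ 2 := by
  rw [psiVar, variance_eq_sub (memLp_psi (by fun_prop) (by fun_prop))]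
  rfl

/-- The two factors have the same mean by exchangeability of the three copies. -/
lemma integral_psi_one_two (S : Measure ℝ) [IsProbabilityMeasure S] :
    ∫ z, psi (z 1) (z 2) ∂(threeCopies S) = limitMean S := by
  let e : Fin 3 ≃ Fin 3 := finRotate 3
  have h := (measurePreserving_piCongrLeft (fun _ : Fin 3 ↦ S) e.symm)
  have h2 := h.integral_comp' (g := fun z ↦ psi (z 0) (z 1))
  rw [limitMean, threeCopies, ← h2]
  rfl

lemma psiCov_eq (S : Measure ℝ) [IsProbabilityMeasure S] :
    psiCov S = ∫ z, psi (z 0) (z 1) * psi (z 1) (z 2) ∂(threeCopies S) - limitMean S ^ 2 := by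
  rw [psiCov, covariance_eq_sub (memLp_psi (by fun_prop) (by fun_prop))
    (memLp_psi (by fun_prop) (by fun_prop)), integral_psi_one_two, sq]
  rfl

lemma tendsto_psiVar (hb : ∀ᶠ i in l, b i ≠ 0) (hc : c ≠ 0)
    (h : Tendsto (fun i ↦ (μ i).map (f := (b i * ·)) (by fun_prop)) l
      (𝓝 (S.map (f := (c * ·)) (by fun_prop)))) (hS : (S : Measure ℝ) {0} = 0) :
    Tendsto (fun i ↦ psiVar (μ i : Measure ℝ)) l (𝓝 (psiVar (S : Measure ℝ))) := by
  simp only [psiVar_eq]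
  refine Tendsto.sub ?_ ((tendsto_limitMean hb hc h hS).pow 2)
  refine tendsto_integral_threeCopies hb hc h hS (by fun_prop) (fun z ↦ ?_)
    (fun _ hz ↦ (continuousAt_psi_apply (Or.inr hz)).pow 2)
    fun b hb z ↦ by rw [psi_mul_mul hb]
  rw [abs_pow]
  exact pow_le_one₀ (abs_nonneg _) (abs_psi_le_one _ _)

lemma tendsto_psiCov (hb : ∀ᶠ i in l, b i ≠ 0) (hc : c ≠ 0)
    (h : Tendsto (fun i ↦ (μ i).map (f := (b i * ·)) (by fun_prop)) l
      (𝓝 (S.map (f := (c * ·)) (by fun_prop)))) (hS : (S : Measure ℝ) {0} = 0) :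
    Tendsto (fun i ↦ psiCov (μ i : Measure ℝ)) l (𝓝 (psiCov (S : Measure ℝ))) := by
  simp only [psiCov_eq]
  refine Tendsto.sub ?_ ((tendsto_limitMean hb hc h hS).pow 2)
  refine tendsto_integral_threeCopies hb hc h hS (by fun_prop) (fun z ↦ ?_)
    (fun _ hz ↦ (continuousAt_psi_apply (Or.inr hz)).mul (continuousAt_psi_apply (Or.inl hz)))
    fun b hb z ↦ by rw [psi_mul_mul hb, psi_mul_mul hb]
  rw [abs_mul]
  exact mul_le_one₀ (abs_psi_le_one _ _) (abs_nonneg _) (abs_psi_le_one _ _)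

end Limits

/-! ### Functionals of consecutive pairs of an i.i.d. sequence -/

/-- `Y` is a sequence of independent variables with common law `μ`. -/
structure IsIID {Ω : Type*} [MeasurableSpace Ω] (Y : ℕ → Ω → ℝ) (μ : Measure ℝ)
    (P : Measure Ω) : Prop where
  measurable : ∀ k, Measurable (Y k)
  indep : iIndepFun Y P
  law : ∀ k, P.map (Y k) = μ

/-- The centred functional `psi (Y_k, Y_{k+1}) - E psi (Y_k, Y_{k+1})` of an i.i.d. sequence `Y` of
law `μ`. -/
noncomputable def psiFluct {Ω : Type*} (Y : ℕ → Ω → ℝ) (μ : Measure ℝ) (k : ℕ) (ω : Ω) : ℝ :=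
  psi (Y k ω) (Y (k + 1) ω) - limitMean μ

lemma limitMean_nonneg (μ : Measure ℝ) : 0 ≤ limitMean μ :=
  integral_nonneg fun _ ↦ psi_nonneg _ _

lemma limitMean_le_one (μ : Measure ℝ) [IsProbabilityMeasure μ] : limitMean μ ≤ 1 := by
  have h : ∫ z, psi (z 0) (z 1) ∂(threeCopies μ) ≤ ∫ _, (1 : ℝ) ∂(threeCopies μ) :=
    integral_mono_of_nonneg (ae_of_all _ fun _ ↦ psi_nonneg _ _) (integrable_const _)
      (ae_of_all _ fun _ ↦ psi_le_one _ _)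
  simpa [limitMean] using h

lemma abs_psiFluct_le {Ω : Type*} (Y : ℕ → Ω → ℝ) (μ : Measure ℝ) [IsProbabilityMeasure μ] (k : ℕ) (ω : Ω) :
    |psiFluct Y μ k ω| ≤ 1 := by
  have h1 := psi_nonneg (Y k ω) (Y (k + 1) ω)
  have h2 := psi_le_one (Y k ω) (Y (k + 1) ω)
  have h3 := limitMean_nonneg μ
  have h4 := limitMean_le_one μ
  rw [psiFluct, abs_le]
  constructor <;> linarith

lemma abs_psiFluct_mul_le {Ω : Type*} (Y : ℕ → Ω → ℝ) (μ : Measure ℝ) [IsProbabilityMeasure μ] (k j : ℕ)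
    (ω : Ω) : |psiFluct Y μ k ω * psiFluct Y μ j ω| ≤ 1 := by
  rw [abs_mul]
  exact mul_le_one₀ (abs_psiFluct_le Y μ k ω) (abs_nonneg _) (abs_psiFluct_le Y μ j ω)

lemma integrable_of_bound {Ω : Type*} [MeasurableSpace Ω] {P : Measure Ω} [IsFiniteMeasure P]
    {f : Ω → ℝ} (hf : Measurable f) (C : ℝ) (hC : ∀ ω, |f ω| ≤ C) :
    Integrable f P :=
  (integrable_const C).mono' hf.aestronglyMeasurable (ae_of_all _ hC)

variable {Ω : Type*} [MeasurableSpace Ω] {P : Measure Ω} {Y : ℕ → Ω → ℝ} {μ : Measure ℝ}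

namespace IsIID

lemma shift (h : IsIID Y μ P) (m : ℕ) : IsIID (fun k ↦ Y (k + m)) μ P :=
  ⟨fun _ ↦ h.measurable _, h.indep.precomp (add_left_injective m), fun _ ↦ h.law _⟩

lemma map_three (h : IsIID Y μ P) (k : ℕ) :
    P.map (fun ω (i : Fin 3) ↦ Y (k + i) ω) = threeCopies μ := by
  have hinj : Function.Injective fun i : Fin 3 ↦ k + (i : ℕ) := fun i j hij ↦ by
    simpa [Fin.ext_iff] using hij
  have := (h.indep.precomp hinj).map_fun_eq_pi_map fun i ↦ (h.measurable _).aemeasurable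
  simp only [h.law] at this
  exact this

@[fun_prop]
lemma measurable_psiFluct (h : IsIID Y μ P) (k : ℕ) : Measurable (psiFluct Y μ k) :=
  ((h.measurable _).psi (h.measurable _)).sub_const _

lemma identDistrib_block (h : IsIID Y μ P) (L j : ℕ) :
    IdentDistrib (fun ω (i : Fin L) ↦ Y (j * L + i) ω) (fun ω (i : Fin L) ↦ Y i ω) P P := by
  have hlaw (m : ℕ) : P.map (fun ω (i : Fin L) ↦ Y (m + i) ω) = Measure.pi fun _ ↦ μ := by
    have hinj : Function.Injective fun i : Fin L ↦ m + (i : ℕ) := fun i j hij ↦ by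
      simpa [Fin.ext_iff] using hij
    have := (h.indep.precomp hinj).map_fun_eq_pi_map fun i ↦ (h.measurable _).aemeasurable
    simpa only [h.law] using this
  refine ⟨(measurable_pi_lambda _ fun i ↦ h.measurable _).aemeasurable,
    (measurable_pi_lambda _ fun i ↦ h.measurable _).aemeasurable, ?_⟩
  rw [hlaw]
  have := hlaw 0
  simp only [zero_add] at this
  rw [this]

lemma integral_three (h : IsIID Y μ P) (k : ℕ) {F : (Fin 3 → ℝ) → ℝ} (hF : Measurable F) :
    ∫ ω, F (fun i ↦ Y (k + i) ω) ∂P = ∫ z, F z ∂(threeCopies μ) := by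
  rw [← h.map_three k, integral_map (measurable_pi_lambda _ fun i ↦ h.measurable _).aemeasurable
    hF.aestronglyMeasurable]

lemma integral_psi (h : IsIID Y μ P) (k : ℕ) :
    ∫ ω, psi (Y k ω) (Y (k + 1) ω) ∂P = limitMean μ :=
  h.integral_three k (F := fun z ↦ psi (z 0) (z 1)) (by fun_prop)

lemma integral_psiFluct_mul_succ [IsProbabilityMeasure μ] (h : IsIID Y μ P) (k : ℕ) :
    ∫ ω, psiFluct Y μ k ω * psiFluct Y μ (k + 1) ω ∂P = psiCov μ := by
  rw [psiCov, covariance, integral_psi_one_two]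
  exact h.integral_three k
    (F := fun z ↦ (psi (z 0) (z 1) - limitMean μ) * (psi (z 1) (z 2) - limitMean μ)) (by fun_prop)

lemma integral_psiFluct_sq (h : IsIID Y μ P) (k : ℕ) :
    ∫ ω, psiFluct Y μ k ω * psiFluct Y μ k ω ∂P = psiVar μ := by
  have hm : AEMeasurable (fun z : Fin 3 → ℝ ↦ psi (z 0) (z 1)) (threeCopies μ) := by fun_prop
  rw [psiVar, ← covariance_self hm, covariance]
  exact h.integral_three k
    (F := fun z ↦ (psi (z 0) (z 1) - limitMean μ) * (psi (z 0) (z 1) - limitMean μ)) (by fun_prop)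

lemma integral_psiFluct [IsProbabilityMeasure P] (h : IsIID Y μ P) (k : ℕ) : ∫ ω, psiFluct Y μ k ω ∂P = 0 := by
  unfold psiFluct
  rw [integral_sub ((memLp_psi (h.measurable _) (h.measurable _)).integrable one_le_two)
    (integrable_const _), h.integral_psi]
  simp

lemma integral_psiFluct_mul_of_le [IsProbabilityMeasure P] (h : IsIID Y μ P) {k j : ℕ}
    (hkj : k + 2 ≤ j) :
    ∫ ω, psiFluct Y μ k ω * psiFluct Y μ j ω ∂P = 0 := by
  have h1 := h.indep.indepFun_prodMk_prodMk h.measurable k (k + 1) j (j + 1) (by lia) (by lia)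
    (by lia) (by lia)
  have hm : Measurable fun p : ℝ × ℝ ↦ psi p.1 p.2 - limitMean μ := measurable_psi.sub_const _
  have h2 : IndepFun (psiFluct Y μ k) (psiFluct Y μ j) P := h1.comp hm hm
  rw [h2.integral_fun_mul_eq_mul_integral (h.measurable_psiFluct k).aestronglyMeasurable
    (h.measurable_psiFluct j).aestronglyMeasurable, h.integral_psiFluct, zero_mul]

variable [IsProbabilityMeasure P] [IsProbabilityMeasure μ]

lemma integrable_psiFluct (h : IsIID Y μ P) (k : ℕ) : Integrable (psiFluct Y μ k) P :=
  integrable_of_bound (h.measurable_psiFluct k) 1 (abs_psiFluct_le Y μ k)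

lemma integrable_psiFluct_mul (h : IsIID Y μ P) (k j : ℕ) :
    Integrable (fun ω ↦ psiFluct Y μ k ω * psiFluct Y μ j ω) P :=
  integrable_of_bound ((h.measurable_psiFluct k).mul (h.measurable_psiFluct j)) 1
    (abs_psiFluct_mul_le Y μ k j)

/-- The sequence is 1-dependent, so a sum over `s` has second moment of order `#s`. -/
lemma integral_sq_sum_le (h : IsIID Y μ P) (s : Finset ℕ) :
    ∫ ω, (∑ k ∈ s, psiFluct Y μ k ω) ^ 2 ∂P ≤ 3 * s.card := by
  have h1 : ∫ ω, (∑ k ∈ s, psiFluct Y μ k ω) ^ 2 ∂P =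
      ∑ k ∈ s, ∑ j ∈ s, ∫ ω, psiFluct Y μ k ω * psiFluct Y μ j ω ∂P := by
    simp only [sq, Finset.sum_mul_sum]
    rw [integral_finsetSum _ fun k _ ↦ integrable_finsetSum _ fun j _ ↦
      h.integrable_psiFluct_mul k j]
    refine Finset.sum_congr rfl fun k _ ↦ ?_
    rw [integral_finsetSum _ fun j _ ↦ h.integrable_psiFluct_mul k j]
  have h2 (k j : ℕ) : ∫ ω, psiFluct Y μ k ω * psiFluct Y μ j ω ∂P ≤
      if j ∈ Finset.Icc (k - 1) (k + 1) then 1 else 0 := by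
    split_ifs with hj
    · calc ∫ ω, psiFluct Y μ k ω * psiFluct Y μ j ω ∂P ≤ ∫ _, (1 : ℝ) ∂P :=
            integral_mono (h.integrable_psiFluct_mul k j) (integrable_const _) fun ω ↦
              (abs_le.1 (abs_psiFluct_mul_le Y μ k j ω)).2
        _ = 1 := by simp
    · rw [Finset.mem_Icc, not_and_or] at hj
      rcases hj with hj | hj
      · simp only [mul_comm (psiFluct Y μ k _)]
        exact (h.integral_psiFluct_mul_of_le (by lia)).le
      · exact (h.integral_psiFluct_mul_of_le (by lia)).le
  rw [h1]
  calc ∑ k ∈ s, ∑ j ∈ s, ∫ ω, psiFluct Y μ k ω * psiFluct Y μ j ω ∂P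
      ≤ ∑ k ∈ s, ∑ j ∈ s, if j ∈ Finset.Icc (k - 1) (k + 1) then (1 : ℝ) else 0 :=
        Finset.sum_le_sum fun k _ ↦ Finset.sum_le_sum fun j _ ↦ h2 k j
    _ ≤ ∑ k ∈ s, (3 : ℝ) := by
        refine Finset.sum_le_sum fun k _ ↦ ?_
        rw [Finset.sum_boole]
        have : (s.filter fun j ↦ j ∈ Finset.Icc (k - 1) (k + 1)).card ≤ 3 := by
          refine (Finset.card_le_card fun j hj ↦ (Finset.mem_filter.1 hj).2).trans ?_
          rw [Nat.card_Icc]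
          lia
        exact_mod_cast this
    _ = 3 * s.card := by rw [Finset.sum_const, nsmul_eq_mul, mul_comm]

/-- The variance of a block of `p + 1` consecutive terms. -/
lemma integral_sq_sum_range (h : IsIID Y μ P) (p : ℕ) :
    ∫ ω, (∑ k ∈ Finset.range (p + 1), psiFluct Y μ k ω) ^ 2 ∂P =
      (p + 1) * psiVar μ + 2 * p * psiCov μ := by
  induction p with
  | zero =>
    simp only [zero_add, Finset.range_one, Finset.sum_singleton, sq]
    rw [h.integral_psiFluct_sq]
    simp
  | succ p ih =>
    have hm (n : ℕ) : Measurable fun ω ↦ ∑ k ∈ Finset.range n, psiFluct Y μ k ω :=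
      Finset.measurable_sum _ fun k _ ↦ h.measurable_psiFluct k
    have hb (n : ℕ) (ω : Ω) : |∑ k ∈ Finset.range n, psiFluct Y μ k ω| ≤ n := by
      refine (Finset.abs_sum_le_sum_abs _ _).trans ?_
      refine (Finset.sum_le_sum fun k _ ↦ abs_psiFluct_le Y μ k ω).trans ?_
      simp
    have i1 : Integrable (fun ω ↦ (∑ k ∈ Finset.range (p + 1), psiFluct Y μ k ω) ^ 2) P :=
      integrable_of_bound ((hm _).pow_const 2) (((p + 1 : ℕ) : ℝ) ^ 2) fun ω ↦ by
        rw [abs_pow]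
        exact pow_le_pow_left₀ (abs_nonneg _) (hb _ ω) 2
    have i2 : Integrable (fun ω ↦ 2 * ∑ k ∈ Finset.range (p + 1),
        psiFluct Y μ k ω * psiFluct Y μ (p + 1) ω) P :=
      (integrable_finsetSum _ fun k _ ↦ h.integrable_psiFluct_mul k _).const_mul 2
    have hcross : ∫ ω, ∑ k ∈ Finset.range (p + 1),
        psiFluct Y μ k ω * psiFluct Y μ (p + 1) ω ∂P = psiCov μ := by
      rw [integral_finsetSum _ fun k _ ↦ h.integrable_psiFluct_mul k _, Finset.sum_range_succ,
        h.integral_psiFluct_mul_succ, Finset.sum_eq_zero, zero_add]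
      intro k hk
      exact h.integral_psiFluct_mul_of_le (by have := Finset.mem_range.1 hk; lia)
    have hexp (ω : Ω) : (∑ k ∈ Finset.range (p + 1 + 1), psiFluct Y μ k ω) ^ 2 =
        (∑ k ∈ Finset.range (p + 1), psiFluct Y μ k ω) ^ 2 +
        2 * ∑ k ∈ Finset.range (p + 1), psiFluct Y μ k ω * psiFluct Y μ (p + 1) ω +
        psiFluct Y μ (p + 1) ω * psiFluct Y μ (p + 1) ω := by
      rw [Finset.sum_range_succ, ← Finset.sum_mul]
      ring
    simp only [hexp]
    have i12 : Integrable (fun ω ↦ (∑ k ∈ Finset.range (p + 1), psiFluct Y μ k ω) ^ 2 +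
        2 * ∑ k ∈ Finset.range (p + 1), psiFluct Y μ k ω * psiFluct Y μ (p + 1) ω) P := i1.add i2
    rw [integral_add i12 (h.integrable_psiFluct_mul _ _), integral_add i1 i2,
      integral_const_mul, ih, hcross, h.integral_psiFluct_sq]
    push_cast
    ring

/-- Disjoint blocks of an i.i.d. sequence are independent. -/
lemma iIndepFun_blocks (h : IsIID Y μ P) (L : ℕ) :
    iIndepFun (fun (j : ℕ) ω (i : Fin L) ↦ Y (j * L + i) ω) P := by
  have hinj : Function.Injective fun p : ℕ × Fin L ↦ p.1 * L + (p.2 : ℕ) := by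
    rintro ⟨j, i⟩ ⟨j', i'⟩ hp
    simp only at hp
    have hL : 0 < L := i.pos
    have h1 : j = j' := by
      have := congrArg (· / L) hp
      simpa [mul_comm _ L, Nat.mul_add_div hL, Nat.div_eq_of_lt i.2, Nat.div_eq_of_lt i'.2]
        using this
    subst h1
    simpa [Fin.ext_iff] using hp
  have h1 := (iIndepFun_iff_map_fun_eq_infinitePi_map (fun p ↦ h.measurable _)).1
    (h.indep.precomp hinj)
  have h2 (j : ℕ) := (iIndepFun_iff_map_fun_eq_infinitePi_map (P := P) (fun i ↦ h.measurable _)).1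
    (h.indep.precomp (hinj.comp (Prod.mk_right_injective (β := Fin L) j)))
  simp only [Function.comp_def, h.law] at h1 h2
  rw [iIndepFun_iff_map_fun_eq_infinitePi_map
    (fun j ↦ measurable_pi_lambda _ fun i ↦ h.measurable _)]
  simp only [h2]
  rw [← Measure.infinitePi_map_curry (μ := fun _ _ ↦ μ), ← h1, Measure.map_map
    (MeasurableEquiv.measurable _) (measurable_pi_lambda _ fun p ↦ h.measurable _)]
  rfl

end IsIID

/-! ### Exponential concentration of the sums -/

namespace IsIID

variable {Ω : Type*} [MeasurableSpace Ω] {P : Measure Ω} [IsProbabilityMeasure P] {Y : ℕ → Ω → ℝ}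
  {μ : Measure ℝ} [IsProbabilityMeasure μ]

/-- Every second term of the 1-dependent sequence: the terms are independent, and Hoeffding's
inequality applies. -/
lemma measureReal_sum_even_ge_le (h : IsIID Y μ P) (n : ℕ) {ε : ℝ} (hε : 0 ≤ ε) :
    P.real {ω | ε ≤ |∑ j ∈ Finset.range n, psiFluct Y μ (j * 2) ω|} ≤
      2 * Real.exp (-ε ^ 2 / (2 * n)) := by
  have hg : Measurable fun z : Fin 2 → ℝ ↦ psi (z 0) (z 1) - limitMean μ :=
    (Measurable.psi (by fun_prop) (by fun_prop)).sub_const _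
  have hind : iIndepFun (fun j ω ↦ psiFluct Y μ (j * 2) ω) P :=
    (h.iIndepFun_blocks 2).comp _ fun _ ↦ hg
  have hsub (j : ℕ) : HasSubgaussianMGF (fun ω ↦ psiFluct Y μ (j * 2) ω) 1 P := by
    have := hasSubgaussianMGF_of_mem_Icc_of_integral_eq_zero (μ := P) (a := -1) (b := 1)
      (h.measurable_psiFluct (j * 2)).aemeasurable
      (ae_of_all _ fun ω ↦ abs_le.1 (abs_psiFluct_le Y μ (j * 2) ω)) (h.integral_psiFluct _)
    convert this
    ext
    norm_num
  have h1 := HasSubgaussianMGF.measure_sum_range_ge_le_of_iIndepFun hind (n := n)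
    (fun j _ ↦ hsub j) hε
  have h2 := HasSubgaussianMGF.measure_sum_range_ge_le_of_iIndepFun
    (X := fun j ω ↦ -psiFluct Y μ (j * 2) ω) (n := n)
    (hind.comp (fun _ x ↦ -x) fun _ ↦ measurable_neg) (fun j _ ↦ (hsub j).neg) hε
  simp only [NNReal.coe_one, mul_one, Finset.sum_neg_distrib] at h1 h2
  have hsplit : {ω | ε ≤ |∑ j ∈ Finset.range n, psiFluct Y μ (j * 2) ω|} =
      {ω | ε ≤ ∑ j ∈ Finset.range n, psiFluct Y μ (j * 2) ω} ∪
      {ω | ε ≤ -∑ j ∈ Finset.range n, psiFluct Y μ (j * 2) ω} := by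
    ext ω
    simp [le_abs]
  rw [hsplit]
  linarith [measureReal_union_le (μ := P)
    {ω | ε ≤ ∑ j ∈ Finset.range n, psiFluct Y μ (j * 2) ω}
    {ω | ε ≤ -∑ j ∈ Finset.range n, psiFluct Y μ (j * 2) ω}]

end IsIID

lemma sum_range_eq_even_add_odd (f : ℕ → ℝ) (N : ℕ) :
    ∑ k ∈ Finset.range N, f k =
      ∑ j ∈ Finset.range ((N + 1) / 2), f (j * 2) + ∑ j ∈ Finset.range (N / 2), f (j * 2 + 1) := by
  induction N with
  | zero => simp
  | succ N ih =>
    rw [Finset.sum_range_succ, ih]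
    obtain ⟨m, rfl | rfl⟩ := Nat.even_or_odd' N
    · have h1 : (2 * m + 1) / 2 = m := by lia
      have h2 : (2 * m + 1 + 1) / 2 = m + 1 := by lia
      rw [h1, h2, Finset.sum_range_succ, Nat.mul_div_cancel_left _ two_pos, mul_comm m 2]
      ring
    · have h1 : (2 * m + 1) / 2 = m := by lia
      have h2 : (2 * m + 1 + 1) / 2 = m + 1 := by lia
      have h3 : (2 * m + 1 + 1 + 1) / 2 = m + 1 := by lia
      rw [h1, h2, h3, Finset.sum_range_succ (fun j ↦ f (j * 2 + 1)), mul_comm m 2]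
      ring

namespace IsIID

variable {Ω : Type*} [MeasurableSpace Ω] {P : Measure Ω} [IsProbabilityMeasure P] {Y : ℕ → Ω → ℝ}
  {μ : Measure ℝ} [IsProbabilityMeasure μ]

lemma measureReal_sum_ge_le (h : IsIID Y μ P) {N : ℕ} (hN : 2 ≤ N) {ε : ℝ} (hε : 0 ≤ ε) :
    P.real {ω | ε * N ≤ |∑ k ∈ Finset.range N, psiFluct Y μ k ω|} ≤
      4 * Real.exp (-(ε ^ 2 / 8)) ^ N := by
  have hN0 : (0 : ℝ) < N := by exact_mod_cast (by lia : 0 < N)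
  have hb (n : ℕ) (hn : 0 < n) (hnN : n ≤ N) : Real.exp (-(ε * N / 2) ^ 2 / (2 * n)) ≤
      Real.exp (-(ε ^ 2 / 8)) ^ N := by
    have hn0 : (0 : ℝ) < n := by exact_mod_cast hn
    have hnN' : (n : ℝ) ≤ N := by exact_mod_cast hnN
    rw [← Real.exp_nat_mul, Real.exp_le_exp, div_le_iff₀ (by positivity)]
    nlinarith [mul_nonneg (mul_nonneg (sq_nonneg ε) hN0.le) (sub_nonneg.2 hnN')]
  have h1 := h.measureReal_sum_even_ge_le ((N + 1) / 2) (by positivity : 0 ≤ ε * N / 2)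
  have h2 := (h.shift 1).measureReal_sum_even_ge_le (N / 2) (by positivity : 0 ≤ ε * N / 2)
  have h3 := hb ((N + 1) / 2) (by lia) (by lia)
  have h4 := hb (N / 2) (by lia) (by lia)
  have hsub : {ω | ε * N ≤ |∑ k ∈ Finset.range N, psiFluct Y μ k ω|} ⊆
      {ω | ε * N / 2 ≤ |∑ j ∈ Finset.range ((N + 1) / 2), psiFluct Y μ (j * 2) ω|} ∪
      {ω | ε * N / 2 ≤
        |∑ j ∈ Finset.range (N / 2), psiFluct (fun k ↦ Y (k + 1)) μ (j * 2) ω|} := by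
    intro ω hω
    simp only [Set.mem_union, Set.mem_ofPred_eq] at hω ⊢
    by_contra! hcon
    rw [sum_range_eq_even_add_odd] at hω
    have h5 := abs_add_le (∑ j ∈ Finset.range ((N + 1) / 2), psiFluct Y μ (j * 2) ω)
      (∑ j ∈ Finset.range (N / 2), psiFluct Y μ (j * 2 + 1) ω)
    have h6 := hcon.2
    change |∑ j ∈ Finset.range (N / 2), psiFluct Y μ (j * 2 + 1) ω| < _ at h6
    linarith [hcon.1]
  have h5 := (measureReal_mono hsub).trans (measureReal_union_le (μ := P) _ _)
  linarith

end IsIID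

/-- Strong law for a triangular array: averages over rows of length `N m ≥ m + 2` converge to zero
almost surely. -/
lemma ae_tendsto_average {Ω : Type*} [MeasurableSpace Ω] {P : Measure Ω} [IsProbabilityMeasure P]
    {Y : ℕ → ℕ → Ω → ℝ} {μ : ℕ → Measure ℝ} [∀ m, IsProbabilityMeasure (μ m)]
    (hY : ∀ m, IsIID (Y m) (μ m) P) {N : ℕ → ℕ} (hN : ∀ m, m + 2 ≤ N m) :
    ∀ᵐ ω ∂P, Tendsto (fun m ↦ (∑ k ∈ Finset.range (N m), psiFluct (Y m) (μ m) k ω) / N m) atTop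
      (𝓝 0) := by
  have hBC (j : ℕ) : ∀ᵐ ω ∂P, ∀ᶠ m in atTop, ω ∉
      {ω | 1 / ((j : ℝ) + 1) * N m ≤ |∑ k ∈ Finset.range (N m), psiFluct (Y m) (μ m) k ω|} := by
    refine ae_eventually_notMem ?_
    have hr : Real.exp (-((1 / ((j : ℝ) + 1)) ^ 2 / 8)) < 1 := by
      rw [Real.exp_lt_one_iff]
      simp only [Left.neg_neg_iff]
      positivity
    have hsum : Summable fun m : ℕ ↦ 4 * Real.exp (-((1 / ((j : ℝ) + 1)) ^ 2 / 8)) ^ m :=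
      (summable_geometric_of_lt_one (Real.exp_nonneg _) hr).mul_left 4
    have hle (m : ℕ) : P {ω | 1 / ((j : ℝ) + 1) * N m ≤
        |∑ k ∈ Finset.range (N m), psiFluct (Y m) (μ m) k ω|} ≤
        ENNReal.ofReal (4 * Real.exp (-((1 / ((j : ℝ) + 1)) ^ 2 / 8)) ^ m) := by
      rw [← ofReal_measureReal]
      refine ENNReal.ofReal_le_ofReal (((hY m).measureReal_sum_ge_le (by have := hN m; lia)
        (by positivity)).trans ?_)
      gcongr ?_ * ?_
      exact pow_le_pow_of_le_one (Real.exp_nonneg _) hr.le (by have := hN m; lia)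
    exact ne_top_of_le_ne_top hsum.tsum_ofReal_ne_top (ENNReal.tsum_le_tsum hle)
  filter_upwards [ae_all_iff.2 hBC] with ω hω
  rw [Metric.tendsto_nhds]
  intro ε hε
  obtain ⟨j, hj⟩ := exists_nat_one_div_lt hε
  filter_upwards [hω j] with m hm
  have hN0 : (0 : ℝ) < N m := by exact_mod_cast (by have := hN m; lia : 0 < N m)
  simp only [not_le] at hm
  rw [Real.dist_eq, sub_zero, abs_div, abs_of_pos hN0, div_lt_iff₀ hN0]
  exact hm.trans (by gcongr)

/-! ### Central limit theorem for 1-dependent triangular arrays -/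

lemma norm_pow_sub_pow_le_mul {z w : ℂ} (hz : ‖z‖ ≤ 1) (hw : ‖w‖ ≤ 1) (q : ℕ) :
    ‖z ^ q - w ^ q‖ ≤ q * ‖z - w‖ := by
  induction q with
  | zero => simp
  | succ q ih =>
    have h1 : z ^ (q + 1) - w ^ (q + 1) = (z ^ q - w ^ q) * z + w ^ q * (z - w) := by ring
    rw [h1]
    refine (norm_add_le _ _).trans ?_
    rw [norm_mul, norm_mul, norm_pow]
    have h2 : ‖z ^ q - w ^ q‖ * ‖z‖ ≤ ‖z ^ q - w ^ q‖ := mul_le_of_le_one_right (norm_nonneg _) hz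
    have h3 : ‖w‖ ^ q * ‖z - w‖ ≤ ‖z - w‖ :=
      mul_le_of_le_one_left (norm_nonneg _) (pow_le_one₀ (norm_nonneg _) hw)
    push_cast
    linarith

lemma norm_exp_mul_I_sub_taylor_le (x : ℝ) :
    ‖Complex.exp (x * Complex.I) - (1 + x * Complex.I - x ^ 2 / 2)‖ ≤ 4 * |x| ^ 3 := by
  have hx : ‖(x : ℂ) * Complex.I‖ = |x| := by simp
  rcases le_total |x| 1 with h | h
  · have h1 := Complex.exp_bound (x := x * Complex.I) (by rw [hx]; exact h) (n := 3) (by norm_num)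
    have h2 : ∑ m ∈ Finset.range 3, ((x : ℂ) * Complex.I) ^ m / m.factorial =
        1 + x * Complex.I - x ^ 2 / 2 := by
      simp only [Finset.sum_range_succ, Finset.range_zero, Finset.sum_empty, Nat.factorial, mul_pow,
        Complex.I_sq]
      norm_num
      ring
    rw [h2, hx] at h1
    refine h1.trans ?_
    norm_num [Nat.factorial]
    nlinarith [pow_nonneg (abs_nonneg x) 3]
  · have h1 : ‖Complex.exp (x * Complex.I) - (1 + x * Complex.I - x ^ 2 / 2)‖ ≤
        1 + (1 + |x| + |x| ^ 2 / 2) := by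
      refine (norm_sub_le _ _).trans (add_le_add (Complex.norm_exp_ofReal_mul_I x).le ?_)
      refine (norm_sub_le _ _).trans (add_le_add ((norm_add_le _ _).trans ?_) ?_)
      · rw [hx, norm_one]
      · simp
    have h2 : |x| ≤ |x| ^ 3 := le_self_pow₀ h (by norm_num)
    have h3 : |x| ^ 2 ≤ |x| ^ 3 := pow_le_pow_right₀ h (by norm_num)
    linarith

variable {Ω : Type*} [MeasurableSpace Ω] {P : Measure Ω}

lemma charFun_map_real {U : Ω → ℝ} (hU : Measurable U) (θ : ℝ) :
    charFun (P.map U) θ = ∫ ω, Complex.exp ((θ * U ω : ℝ) * Complex.I) ∂P := by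
  rw [charFun_apply_real, integral_map hU.aemeasurable (by fun_prop)]
  push_cast
  rfl

namespace IsIID

variable {Y : ℕ → Ω → ℝ} {μ : Measure ℝ}

/-- The sum over the first `q` blocks of length `p + 2`, leaving out the last term of each block;
the partial sums over the blocks are independent. -/
noncomputable def blockSum {Ω : Type*} (Y : ℕ → Ω → ℝ) (μ : Measure ℝ) (p q : ℕ) (ω : Ω) : ℝ :=
  ∑ j ∈ Finset.range q, ∑ i ∈ Finset.range (p + 1), psiFluct Y μ (j * (p + 2) + i) ω

lemma measurable_blockSum (h : IsIID Y μ P) (p q : ℕ) : Measurable (blockSum Y μ p q) :=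
  Finset.measurable_sum _ fun _ _ ↦ Finset.measurable_sum _ fun _ _ ↦ h.measurable_psiFluct _

end IsIID

variable [IsProbabilityMeasure P]

lemma integrable_exp_mul_I {U : Ω → ℝ} (hU : Measurable U) :
    Integrable (fun ω ↦ Complex.exp ((U ω : ℂ) * Complex.I)) P :=
  (integrable_const (1 : ℝ)).mono' (by fun_prop)
    (ae_of_all _ fun ω ↦ (Complex.norm_exp_ofReal_mul_I _).le)

/-- Second order expansion of the characteristic function of a bounded centred variable. -/
lemma norm_charFun_sub_le {W : Ω → ℝ} (hW : Measurable W) {C : ℝ} (hC : ∀ ω, |W ω| ≤ C)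
    (h0 : ∫ ω, W ω ∂P = 0) (s : ℝ) :
    ‖charFun (P.map W) s - ((1 - s ^ 2 * (∫ ω, W ω ^ 2 ∂P) / 2 : ℝ) : ℂ)‖ ≤
      4 * (|s| * C) ^ 3 := by
  have i1 : Integrable W P := integrable_of_bound hW C hC
  have i2 : Integrable (fun ω ↦ W ω ^ 2) P :=
    integrable_of_bound (hW.pow_const 2) (C ^ 2) fun ω ↦ by
      rw [abs_pow]; exact pow_le_pow_left₀ (abs_nonneg _) (hC ω) 2
  have hpoly : ∫ ω, (1 + ((s * W ω : ℝ) : ℂ) * Complex.I - ((s * W ω : ℝ) : ℂ) ^ 2 / 2) ∂P =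
      ((1 - s ^ 2 * (∫ ω, W ω ^ 2 ∂P) / 2 : ℝ) : ℂ) := by
    have e1 (ω : Ω) : (1 + ((s * W ω : ℝ) : ℂ) * Complex.I - ((s * W ω : ℝ) : ℂ) ^ 2 / 2) =
        1 + (W ω : ℂ) * (s * Complex.I) - ((W ω ^ 2 : ℝ) : ℂ) * (s ^ 2 / 2) := by
      push_cast; ring
    simp only [e1]
    have j1 : Integrable (fun ω ↦ (W ω : ℂ) * (s * Complex.I)) P := i1.ofReal.mul_const _
    have j2 : Integrable (fun ω ↦ ((W ω ^ 2 : ℝ) : ℂ) * (s ^ 2 / 2)) P := i2.ofReal.mul_const _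
    have j0 : Integrable (fun ω ↦ 1 + (W ω : ℂ) * (s * Complex.I)) P :=
      (integrable_const (1 : ℂ)).add j1
    rw [integral_sub j0 j2, integral_add (integrable_const _) j1, integral_mul_const,
      integral_mul_const, integral_complex_ofReal, integral_complex_ofReal, h0]
    simp
    ring
  have j3 : Integrable (fun ω ↦ 1 + ((s * W ω : ℝ) : ℂ) * Complex.I -
      ((s * W ω : ℝ) : ℂ) ^ 2 / 2) P := by
    refine (((integrable_const (1 : ℂ)).add ((i1.const_mul s).ofReal.mul_const Complex.I)).sub
      ((i2.const_mul (s ^ 2)).ofReal.div_const 2)).congr (ae_of_all _ fun ω ↦ ?_)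
    simp
    ring
  rw [charFun_map_real hW, ← hpoly, ← integral_sub (integrable_exp_mul_I (hW.const_mul s)) j3]
  refine (norm_integral_le_of_norm_le_const (C := 4 * (|s| * C) ^ 3) (ae_of_all _ fun ω ↦ ?_)).trans
    (by simp)
  refine (norm_exp_mul_I_sub_taylor_le _).trans ?_
  rw [abs_mul]
  have := hC ω
  gcongr

lemma integral_abs_le_sqrt {W : Ω → ℝ} (hW : MemLp W 2 P) :
    ∫ ω, |W ω| ∂P ≤ √(∫ ω, W ω ^ 2 ∂P) := by
  refine Real.le_sqrt_of_sq_le ?_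
  have h := variance_nonneg (fun ω ↦ |W ω|) P
  have hm : MemLp (fun ω ↦ |W ω|) 2 P := hW.abs
  rw [variance_eq_sub hm] at h
  simpa using h

/-- Characteristic functions of variables that are close in mean square. -/
lemma norm_charFun_map_sub_charFun_map_le {U V : Ω → ℝ} (hU : Measurable U) (hV : Measurable V)
    (hUV : MemLp (fun ω ↦ U ω - V ω) 2 P) (θ : ℝ) :
    ‖charFun (P.map U) θ - charFun (P.map V) θ‖ ≤ |θ| * √(∫ ω, (U ω - V ω) ^ 2 ∂P) := by
  rw [charFun_map_real hU, charFun_map_real hV, ← integral_sub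
    (integrable_exp_mul_I (hU.const_mul θ)) (integrable_exp_mul_I (hV.const_mul θ))]
  have hb (ω : Ω) : ‖Complex.exp ((θ * U ω : ℝ) * Complex.I) -
      Complex.exp ((θ * V ω : ℝ) * Complex.I)‖ ≤ |θ| * |U ω - V ω| := by
    have h1 : Complex.exp ((θ * U ω : ℝ) * Complex.I) - Complex.exp ((θ * V ω : ℝ) * Complex.I) =
        Complex.exp ((θ * V ω : ℝ) * Complex.I) *
          (Complex.exp (Complex.I * (θ * (U ω - V ω) : ℝ)) - 1) := by
      rw [mul_sub, ← Complex.exp_add, mul_one]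
      congr 2
      push_cast
      ring
    rw [h1, norm_mul, Complex.norm_exp_ofReal_mul_I, one_mul, ← abs_mul]
    exact Real.norm_exp_I_mul_ofReal_sub_one_le
  have hint : Integrable (fun ω ↦ |U ω - V ω|) P := (hUV.integrable one_le_two).abs
  calc _ ≤ ∫ ω, |θ| * |U ω - V ω| ∂P :=
        norm_integral_le_of_norm_le (hint.const_mul _) (ae_of_all _ hb)
    _ = |θ| * ∫ ω, |U ω - V ω| ∂P := integral_const_mul _ _
    _ ≤ _ := by
        gcongr
        exact integral_abs_le_sqrt hUV

lemma abs_exp_neg_sub_le {x : ℝ} (hx : |x| ≤ 1) : |(1 - x) - Real.exp (-x)| ≤ x ^ 2 := by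
  have := Real.norm_exp_sub_one_sub_id_le (x := -x) (by simpa using hx)
  rw [norm_neg, Real.norm_eq_abs, Real.norm_eq_abs, sq_abs] at this
  rw [abs_sub_comm]
  convert this using 2
  ring

lemma sum_range_mul_eq (f : ℕ → ℝ) (q L : ℕ) :
    ∑ k ∈ Finset.range (q * L), f k =
      ∑ j ∈ Finset.range q, ∑ i ∈ Finset.range L, f (j * L + i) := by
  induction q with
  | zero => simp
  | succ q ih => rw [Nat.succ_mul, Finset.sum_range_add, ih, Finset.sum_range_succ]

namespace IsIID

variable {Y : ℕ → Ω → ℝ} {μ : Measure ℝ} [IsProbabilityMeasure μ]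

lemma charFun_blockSum (h : IsIID Y μ P) (p q : ℕ) (b θ : ℝ) :
    charFun (P.map fun ω ↦ b * blockSum Y μ p q ω) θ =
      charFun (P.map fun ω ↦ ∑ i ∈ Finset.range (p + 1), psiFluct Y μ i ω) (b * θ) ^ q := by
  let g : (Fin (p + 2) → ℝ) → ℝ := fun z ↦
    ∑ i : Fin (p + 1), (psi (z i.castSucc) (z i.succ) - limitMean μ)
  have hg : Measurable g := Finset.measurable_sum _ fun i _ ↦
    (Measurable.psi (by fun_prop) (by fun_prop)).sub_const _
  have hB (j : ℕ) : (fun ω ↦ ∑ i ∈ Finset.range (p + 1), psiFluct Y μ (j * (p + 2) + i) ω) =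
      g ∘ fun ω (i : Fin (p + 2)) ↦ Y (j * (p + 2) + i) ω := by
    ext ω
    simp only [Finset.sum_range, g, Function.comp_apply, psiFluct]
    rfl
  have hB0 : (fun ω ↦ ∑ i ∈ Finset.range (p + 1), psiFluct Y μ i ω) =
      g ∘ fun ω (i : Fin (p + 2)) ↦ Y i ω := by
    ext ω
    simp only [Finset.sum_range, g, Function.comp_apply, psiFluct]
    rfl
  have hm (j : ℕ) : AEMeasurable
      (fun ω ↦ ∑ i ∈ Finset.range (p + 1), psiFluct Y μ (j * (p + 2) + i) ω) P :=
    (Finset.measurable_sum _ fun _ _ ↦ h.measurable_psiFluct _).aemeasurable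
  have hind : iIndepFun
      (fun j ω ↦ ∑ i ∈ Finset.range (p + 1), psiFluct Y μ (j * (p + 2) + i) ω) P := by
    rw [funext hB]
    exact (h.iIndepFun_blocks (p + 2)).comp _ fun _ ↦ hg
  have hlaw (j : ℕ) : P.map
      (fun ω ↦ ∑ i ∈ Finset.range (p + 1), psiFluct Y μ (j * (p + 2) + i) ω) =
      P.map fun ω ↦ ∑ i ∈ Finset.range (p + 1), psiFluct Y μ i ω := by
    rw [hB, hB0]
    exact ((h.identDistrib_block (p + 2) j).comp hg).map_eq
  rw [charFun_map_mul_comp (h.measurable_blockSum p q).aemeasurable]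
  unfold blockSum
  rw [(hind.restrict _).charFun_map_fun_finsetSum_eq_prod (fun _ _ ↦ hm _), Finset.prod_apply]
  simp [hlaw]

/-- The sum over a row differs from its block sum by few terms. -/
lemma integral_sq_sum_sub_blockSum_le (h : IsIID Y μ P) (p N : ℕ) :
    ∫ ω, (∑ k ∈ Finset.range N, psiFluct Y μ k ω - blockSum Y μ p (N / (p + 2)) ω) ^ 2 ∂P ≤
      3 * ((N / (p + 2) : ℕ) + (p + 2)) := by
  set q := N / (p + 2) with hq
  have hqN : q * (p + 2) ≤ N := Nat.div_mul_le_self N (p + 2)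
  have hNq : N < q * (p + 2) + (p + 2) := by
    have := Nat.lt_div_mul_add (a := N) (b := p + 2) (by lia)
    lia
  let D : Finset ℕ := (Finset.range q).image (fun j ↦ j * (p + 2) + (p + 1)) ∪
    Finset.Ico (q * (p + 2)) N
  have hdisj : Disjoint ((Finset.range q).image (fun j ↦ j * (p + 2) + (p + 1)))
      (Finset.Ico (q * (p + 2)) N) := by
    rw [Finset.disjoint_left]
    intro k hk hk'
    obtain ⟨j, hj, rfl⟩ := Finset.mem_image.1 hk
    have h1 : j + 1 ≤ q := Finset.mem_range.1 hj
    have h2 := (Finset.mem_Ico.1 hk').1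
    nlinarith [Nat.mul_le_mul_right (p + 2) h1]
  have hinj : Set.InjOn (fun j ↦ j * (p + 2) + (p + 1)) (Finset.range q : Set ℕ) := by
    intro i _ j _ hij
    simp only [add_left_inj] at hij
    exact Nat.eq_of_mul_eq_mul_right (by lia) hij
  have hD (ω : Ω) : ∑ k ∈ Finset.range N, psiFluct Y μ k ω - blockSum Y μ p q ω =
      ∑ k ∈ D, psiFluct Y μ k ω := by
    rw [Finset.sum_union hdisj, Finset.sum_image hinj, ← Finset.sum_range_add_sum_Ico _ hqN,
      sum_range_mul_eq, blockSum]
    simp only [Finset.sum_range_succ _ (p + 1), Finset.sum_add_distrib]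
    ring
  have hcard : D.card ≤ q + (p + 2) := by
    refine (Finset.card_union_le _ _).trans (add_le_add ?_ ?_)
    · exact Finset.card_image_le.trans (Finset.card_range q).le
    · rw [Nat.card_Ico]; lia
  simp only [hD]
  refine (h.integral_sq_sum_le D).trans ?_
  have : (D.card : ℝ) ≤ q + (p + 2) := by exact_mod_cast hcard
  linarith

end IsIID

variable {Ω : Type*} [MeasurableSpace Ω] {P : Measure Ω} [IsProbabilityMeasure P]

/-- Row-wise error bound: the characteristic function of a normalized row sum against that of a
Gaussian variable whose variance is that of `q = N / (p + 2)` independent blocks. -/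
lemma IsIID.norm_charFun_sum_sub_le {Y : ℕ → Ω → ℝ} {μ : Measure ℝ} [IsProbabilityMeasure μ]
    (h : IsIID Y μ P) (p N : ℕ) (b θ : ℝ) {x : ℝ}
    (hx : x = (b * θ) ^ 2 * ((p + 1) * psiVar μ + 2 * p * psiCov μ) / 2) (hx1 : |x| ≤ 1) :
    ‖charFun (P.map fun ω ↦ b * ∑ k ∈ Finset.range N, psiFluct Y μ k ω) θ -
        (Real.exp (-((N / (p + 2) : ℕ) * x)) : ℂ)‖ ≤
      |θ| * √(b ^ 2 * (3 * ((N / (p + 2) : ℕ) + (p + 2)))) +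
      (N / (p + 2) : ℕ) * (4 * (|b * θ| * (p + 1)) ^ 3 + x ^ 2) := by
  set q := N / (p + 2) with hq
  have hmS : Measurable fun ω ↦ ∑ k ∈ Finset.range N, psiFluct Y μ k ω :=
    Finset.measurable_sum _ fun _ _ ↦ h.measurable_psiFluct _
  have hsumb (n : ℕ) (ω : Ω) : |∑ k ∈ Finset.range n, psiFluct Y μ k ω| ≤ n := by
    refine (Finset.abs_sum_le_sum_abs _ _).trans ?_
    refine (Finset.sum_le_sum fun k _ ↦ abs_psiFluct_le Y μ k ω).trans ?_
    simp
  have hmB := h.measurable_blockSum p q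
  have hB0 : x = (b * θ) ^ 2 *
      (∫ ω, (∑ i ∈ Finset.range (p + 1), psiFluct Y μ i ω) ^ 2 ∂P) / 2 := by
    rw [h.integral_sq_sum_range, hx]
  have hx0 : 0 ≤ x := by
    rw [hB0]
    have : 0 ≤ ∫ ω, (∑ i ∈ Finset.range (p + 1), psiFluct Y μ i ω) ^ 2 ∂P :=
      integral_nonneg fun ω ↦ sq_nonneg _
    positivity
  -- leaving out the last term of each block
  have e1 : ‖charFun (P.map fun ω ↦ b * ∑ k ∈ Finset.range N, psiFluct Y μ k ω) θ -
      charFun (P.map fun ω ↦ b * blockSum Y μ p q ω) θ‖ ≤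
      |θ| * √(b ^ 2 * (3 * ((q : ℕ) + (p + 2)))) := by
    have hL2 : MemLp (fun ω ↦ b * ∑ k ∈ Finset.range N, psiFluct Y μ k ω -
        b * blockSum Y μ p q ω) 2 P := by
      refine MemLp.of_bound ((hmS.const_mul b).sub (hmB.const_mul b)).aestronglyMeasurable
        (|b| * (N + q * (p + 1))) (ae_of_all _ fun ω ↦ ?_)
      rw [← mul_sub, norm_mul, Real.norm_eq_abs, Real.norm_eq_abs]
      gcongr
      refine (abs_sub _ _).trans (add_le_add (hsumb N ω) ?_)
      refine (Finset.abs_sum_le_sum_abs _ _).trans ?_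
      refine (Finset.sum_le_sum (g := fun _ ↦ ((p : ℝ) + 1)) fun j _ ↦ ?_).trans (by simp [mul_add])
      refine (Finset.abs_sum_le_sum_abs _ _).trans ?_
      refine (Finset.sum_le_sum fun k _ ↦ abs_psiFluct_le Y μ _ ω).trans ?_
      simp
    refine (norm_charFun_map_sub_charFun_map_le (hmS.const_mul b) (hmB.const_mul b) hL2 θ).trans ?_
    gcongr
    simp only [← mul_sub, mul_pow]
    rw [integral_const_mul]
    gcongr
    exact h.integral_sq_sum_sub_blockSum_le p N
  -- expansion of the characteristic function of one block
  have hm0 : Measurable fun ω ↦ ∑ i ∈ Finset.range (p + 1), psiFluct Y μ i ω :=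
    Finset.measurable_sum _ fun _ _ ↦ h.measurable_psiFluct _
  have hmean : ∫ ω, ∑ i ∈ Finset.range (p + 1), psiFluct Y μ i ω ∂P = 0 := by
    rw [integral_finsetSum _ fun k _ ↦ h.integrable_psiFluct k]
    simp [h.integral_psiFluct]
  have e2 := norm_charFun_sub_le hm0 (hsumb (p + 1)) hmean (b * θ)
  rw [← hB0] at e2
  have e3 : ‖((1 - x : ℝ) : ℂ) - (Real.exp (-x) : ℂ)‖ ≤ x ^ 2 := by
    rw [← Complex.ofReal_sub, Complex.norm_real]
    exact abs_exp_neg_sub_le hx1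
  have e4 : ‖charFun (P.map fun ω ↦ b * blockSum Y μ p q ω) θ -
      (Real.exp (-(q * x)) : ℂ)‖ ≤ q * (4 * (|b * θ| * (p + 1)) ^ 3 + x ^ 2) := by
    have h1 : (Real.exp (-(q * x)) : ℂ) = (Real.exp (-x) : ℂ) ^ q := by
      rw [← Complex.ofReal_pow, ← Real.exp_nat_mul, mul_neg]
    have : IsProbabilityMeasure
        (P.map fun ω ↦ ∑ i ∈ Finset.range (p + 1), psiFluct Y μ i ω) :=
      Measure.isProbabilityMeasure_map hm0.aemeasurable
    rw [h.charFun_blockSum, h1]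
    refine (norm_pow_sub_pow_le_mul (norm_charFun_le_one _) ?_ q).trans ?_
    · rw [Complex.norm_real, Real.norm_of_nonneg (Real.exp_nonneg _), Real.exp_le_one_iff]
      linarith
    · gcongr
      push_cast at e2
      exact (norm_sub_le_norm_sub_add_norm_sub _ ((1 - x : ℝ) : ℂ) _).trans
        (add_le_add (by simpa using e2) e3)
  exact (norm_sub_le_norm_sub_add_norm_sub _
    (charFun (P.map fun ω ↦ b * blockSum Y μ p q ω) θ) _).trans (add_le_add e1 e4)

section Array

variable {Y : ℕ → ℕ → Ω → ℝ} {μ : ℕ → Measure ℝ} [∀ m, IsProbabilityMeasure (μ m)]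
  {N : ℕ → ℕ} {b : ℕ → ℝ} {B v κ : ℝ}

lemma tendsto_sq_mul_div (hN : Tendsto N atTop atTop)
    (hb : Tendsto (fun m ↦ b m ^ 2 * N m) atTop (𝓝 B)) (L : ℕ) (hL : 0 < L) :
    Tendsto (fun m ↦ b m ^ 2 * (N m / L : ℕ)) atTop (𝓝 (B / L)) := by
  have hNr : Tendsto (fun m ↦ (N m : ℝ)) atTop atTop := tendsto_natCast_atTop_atTop.comp hN
  have h1 : Tendsto (fun m ↦ ((N m / L : ℕ) : ℝ) / N m) atTop (𝓝 (1 / L)) := by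
    have h2 := (tendsto_nat_floor_mul_div_atTop (R := ℝ) (a := 1 / L) (by positivity)).comp hNr
    refine h2.congr fun m ↦ ?_
    simp only [Function.comp_apply]
    rw [one_div_mul_eq_div, Nat.floor_div_eq_div]
  have h3 := hb.mul h1
  rw [mul_one_div] at h3
  refine h3.congr' ?_
  filter_upwards [hNr.eventually_gt_atTop 0] with m hm
  field_simp

lemma tendsto_sq_zero (hN : Tendsto N atTop atTop)
    (hb : Tendsto (fun m ↦ b m ^ 2 * N m) atTop (𝓝 B)) :
    Tendsto (fun m ↦ b m ^ 2) atTop (𝓝 0) := by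
  have hNr : Tendsto (fun m ↦ (N m : ℝ)) atTop atTop := tendsto_natCast_atTop_atTop.comp hN
  have h3 := hb.mul (tendsto_inv_atTop_zero.comp hNr)
  rw [mul_zero] at h3
  refine h3.congr' ?_
  filter_upwards [hNr.eventually_gt_atTop 0] with m hm
  simp only [Function.comp_apply]
  field_simp

/-- Central limit theorem for the triangular array, at the level of characteristic functions. The
blocks have a fixed length, which tends to infinity after the row index. -/
lemma tendsto_charFun_array (hY : ∀ m, IsIID (Y m) (μ m) P) (hN : Tendsto N atTop atTop)
    (hb : Tendsto (fun m ↦ b m ^ 2 * N m) atTop (𝓝 B))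
    (hv : Tendsto (fun m ↦ psiVar (μ m)) atTop (𝓝 v))
    (hκ : Tendsto (fun m ↦ psiCov (μ m)) atTop (𝓝 κ)) (θ : ℝ) :
    Tendsto (fun m ↦ charFun (P.map fun ω ↦
      b m * ∑ k ∈ Finset.range (N m), psiFluct (Y m) (μ m) k ω) θ) atTop
      (𝓝 (Real.exp (-(B * (v + 2 * κ) * θ ^ 2 / 2)) : ℂ)) := by
  set E : ℂ := (Real.exp (-(B * (v + 2 * κ) * θ ^ 2 / 2)) : ℂ) with hE
  let x : ℕ → ℕ → ℝ := fun p m ↦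
    (b m * θ) ^ 2 * ((p + 1) * psiVar (μ m) + 2 * p * psiCov (μ m)) / 2
  let X : ℕ → ℝ := fun p ↦ B / (p + 2 : ℕ) * (θ ^ 2 * ((p + 1) * v + 2 * p * κ) / 2)
  have hb2 := tendsto_sq_zero hN hb
  have hw (p : ℕ) : Tendsto (fun m ↦ θ ^ 2 * ((p + 1) * psiVar (μ m) + 2 * p * psiCov (μ m)) / 2)
      atTop (𝓝 (θ ^ 2 * ((p + 1) * v + 2 * p * κ) / 2)) :=
    (((hv.const_mul _).add (hκ.const_mul _)).const_mul _).div_const _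
  have hx0 (p : ℕ) : Tendsto (x p) atTop (𝓝 0) := by
    have := hb2.mul (hw p)
    rw [zero_mul] at this
    refine this.congr fun m ↦ ?_
    simp only [x]
    ring
  have hqx (p : ℕ) : Tendsto (fun m ↦ ((N m / (p + 2) : ℕ) : ℝ) * x p m) atTop (𝓝 (X p)) := by
    refine ((tendsto_sq_mul_div hN hb (p + 2) (by lia)).mul (hw p)).congr fun m ↦ ?_
    simp only [x]
    ring
  -- the row-wise error terms, for a fixed block length
  have herr (p : ℕ) : Tendsto (fun m ↦
      |θ| * √(b m ^ 2 * (3 * ((N m / (p + 2) : ℕ) + (p + 2)))) +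
      (N m / (p + 2) : ℕ) * (4 * (|b m * θ| * (p + 1)) ^ 3 + x p m ^ 2)) atTop
      (𝓝 (|θ| * √(3 * (B / (p + 2 : ℕ))))) := by
    have h1 : Tendsto (fun m ↦ b m ^ 2 * (3 * ((N m / (p + 2) : ℕ) + ((p : ℝ) + 2)))) atTop
        (𝓝 (3 * (B / (p + 2 : ℕ)))) := by
      have := ((tendsto_sq_mul_div hN hb (p + 2) (by lia)).const_mul 3).add
        (hb2.mul_const (3 * ((p : ℝ) + 2)))
      rw [zero_mul, add_zero] at this
      refine this.congr fun m ↦ ?_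
      ring
    have hbabs : Tendsto (fun m ↦ |b m|) atTop (𝓝 0) := by
      have := hb2.sqrt
      simpa [Real.sqrt_sq_eq_abs] using this
    have h2 : Tendsto (fun m ↦ (b m ^ 2 * (N m / (p + 2) : ℕ)) *
        (|b m| * (4 * (|θ| * (p + 1)) ^ 3))) atTop (𝓝 0) := by
      have := (tendsto_sq_mul_div hN hb (p + 2) (by lia)).mul
        (hbabs.mul_const (4 * (|θ| * ((p : ℝ) + 1)) ^ 3))
      simpa using this
    have h3 : Tendsto (fun m ↦ ((N m / (p + 2) : ℕ) * x p m) * x p m) atTop (𝓝 0) := by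
      have := (hqx p).mul (hx0 p)
      simpa using this
    have h4 := ((h1.sqrt).const_mul |θ|).add (h2.add h3)
    rw [add_zero, add_zero] at h4
    refine h4.congr fun m ↦ ?_
    rw [abs_mul, ← sq_abs (b m)]
    ring
  -- both the block error and the deviation of the block variance vanish for long blocks
  have hp : Tendsto (fun p : ℕ ↦ |θ| * √(3 * (B / (p + 2 : ℕ))) +
      ‖(Real.exp (-X p) : ℂ) - E‖) atTop (𝓝 0) := by
    have hcast : Tendsto (fun p : ℕ ↦ ((p + 2 : ℕ) : ℝ)) atTop atTop :=
      tendsto_natCast_atTop_atTop.comp (tendsto_add_atTop_nat 2)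
    have h1 : Tendsto (fun p : ℕ ↦ B / ((p + 2 : ℕ) : ℝ)) atTop (𝓝 0) :=
      tendsto_const_nhds.div_atTop hcast
    have h2 : Tendsto X atTop (𝓝 (B * (v + 2 * κ) * θ ^ 2 / 2)) := by
      have h3 := (h1.mul_const (θ ^ 2 * (-v - 4 * κ) / 2)).const_add
        (B * (v + 2 * κ) * θ ^ 2 / 2)
      rw [zero_mul, add_zero] at h3
      refine h3.congr fun p ↦ ?_
      have : ((p + 2 : ℕ) : ℝ) ≠ 0 := by positivity
      simp only [X]
      field_simp
      push_cast
      ring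
    have h4 : Tendsto (fun p ↦ (Real.exp (-X p) : ℂ)) atTop (𝓝 E) :=
      (Complex.continuous_ofReal.tendsto _).comp ((Real.continuous_exp.tendsto _).comp h2.neg)
    have h5 := ((h1.const_mul 3).sqrt.const_mul |θ|).add (h4.sub_const E).norm
    simpa using h5
  rw [Metric.tendsto_nhds]
  intro ε hε
  obtain ⟨p, hpε⟩ := (hp.eventually_lt_const hε).exists
  have h1 : Tendsto (fun m ↦ (Real.exp (-((N m / (p + 2) : ℕ) * x p m)) : ℂ)) atTop
      (𝓝 (Real.exp (-X p) : ℂ)) :=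
    (Complex.continuous_ofReal.tendsto _).comp ((Real.continuous_exp.tendsto _).comp (hqx p).neg)
  have h2 := ((herr p).add (h1.sub_const E).norm).eventually_lt_const hpε
  have h3 : ∀ᶠ m in atTop, |x p m| ≤ 1 := by
    have := (hx0 p).abs
    rw [abs_zero] at this
    exact this.eventually_le_const one_pos
  filter_upwards [h2, h3] with m hm hm1
  rw [dist_eq_norm]
  refine lt_of_le_of_lt ?_ hm
  exact (norm_sub_le_norm_sub_add_norm_sub _
    (Real.exp (-((N m / (p + 2) : ℕ) * x p m)) : ℂ) _).trans
    (add_le_add_left ((hY m).norm_charFun_sum_sub_le p (N m) (b m) θ rfl hm1) _)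

/-- The asymptotic variance is nonnegative, as a limit of variances of normalized sums. -/
lemma psiVar_add_two_mul_psiCov_nonneg (hY : ∀ m, IsIID (Y m) (μ m) P)
    (hv : Tendsto (fun m ↦ psiVar (μ m)) atTop (𝓝 v))
    (hκ : Tendsto (fun m ↦ psiCov (μ m)) atTop (𝓝 κ)) : 0 ≤ v + 2 * κ := by
  have h1 (p : ℕ) : 0 ≤ ((p : ℝ) + 1) * v + 2 * p * κ := by
    refine ge_of_tendsto' ((hv.const_mul ((p : ℝ) + 1)).add (hκ.const_mul (2 * (p : ℝ)))) fun m ↦ ?_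
    rw [← (hY m).integral_sq_sum_range]
    exact integral_nonneg fun _ ↦ sq_nonneg _
  have h2 : Tendsto (fun p : ℕ ↦ v + 2 * κ - 2 * κ * (1 / ((p : ℝ) + 1))) atTop
      (𝓝 (v + 2 * κ)) := by
    simpa using (tendsto_one_div_add_atTop_nhds_zero_nat.const_mul (2 * κ)).const_sub (v + 2 * κ)
  refine ge_of_tendsto' h2 fun p ↦ ?_
  have h3 : v + 2 * κ - 2 * κ * (1 / ((p : ℝ) + 1)) =
      (((p : ℝ) + 1) * v + 2 * p * κ) / (p + 1) := by
    have : (p : ℝ) + 1 ≠ 0 := by positivity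
    field_simp
    ring
  rw [h3]
  exact div_nonneg (h1 p) (by positivity)

end Array

end LevyIR

namespace LevyIR

/-! ### Second order increments of a Lévy process -/

/-- The non-overlapping second order increments `Δ^{2,n}_{2k} X`. -/
noncomputable def evenIncr {Ω : Type*} (X : ℝ≥0 → Ω → ℝ) (n k : ℕ) (ω : Ω) : ℝ :=
  secondIncr n (2 * k) fun t ↦ X t ω

lemma evenIncr_eq {Ω : Type*} (X : ℝ≥0 → Ω → ℝ) (n k : ℕ) (ω : Ω) :
    evenIncr X n k ω =
      (X (((k * 2 + 1 + 1 : ℕ) : ℝ≥0) / n) ω - X (((k * 2 + 1 : ℕ) : ℝ≥0) / n) ω) -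
      (X (((k * 2 + 0 + 1 : ℕ) : ℝ≥0) / n) ω - X (((k * 2 + 0 : ℕ) : ℝ≥0) / n) ω) := by
  rw [evenIncr, secondIncr, mul_comm 2 k]
  simp only [add_zero, add_assoc, one_add_one_eq_two]
  ring

lemma irStat_two_mul {Ω : Type*} (X : ℝ≥0 → Ω → ℝ) (m : ℕ) (ω : Ω) :
    irStat X (2 * m) ω = 1 / ((m : ℝ) - 1) *
      ∑ k ∈ Finset.range (m - 1), psi (evenIncr X (2 * m) k ω) (evenIncr X (2 * m) (k + 1) ω) := by
  rw [irStat, Nat.mul_div_cancel_left _ two_pos]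
  congr 2
  · push_cast
    ring

variable {Ω : Type*} [MeasurableSpace Ω] {P : Measure Ω} {X : ℝ≥0 → Ω → ℝ}

lemma IsLevyProcess.isIID_increments (hX : IsLevyProcess X P) (n : ℕ) :
    IsIID (fun k ω ↦ X (((k + 1 : ℕ) : ℝ≥0) / n) ω - X ((k : ℝ≥0) / n) ω)
      (P.map (X (1 / n))) P where
  measurable k := (hX.measurable _).sub (hX.measurable _)
  indep := hX.indepIncrements.nat (t := fun k : ℕ ↦ (k : ℝ≥0) / n) fun i j hij ↦ by
    dsimp only
    gcongr
  law k := by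
    have h := (hX.stationary ((k : ℝ≥0) / n) (1 / n)).map_eq
    rw [← add_div] at h
    exact_mod_cast h

lemma IsLevyProcess.isIID_evenIncr [IsProbabilityMeasure P] (hX : IsLevyProcess X P) (n : ℕ) :
    IsIID (evenIncr X n) (P.map (evenIncr X n 0)) P := by
  have hD := hX.isIID_increments n
  have : IsProbabilityMeasure (P.map (X (1 / n))) :=
    Measure.isProbabilityMeasure_map (hX.measurable _).aemeasurable
  have hg : Measurable fun z : Fin 2 → ℝ ↦ z 1 - z 0 := by fun_prop
  have hY (k : ℕ) : evenIncr X n k = (fun z : Fin 2 → ℝ ↦ z 1 - z 0) ∘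
      fun ω (i : Fin 2) ↦ X (((k * 2 + i + 1 : ℕ) : ℝ≥0) / n) ω -
        X (((k * 2 + i : ℕ) : ℝ≥0) / n) ω := by
    ext ω
    exact evenIncr_eq X n k ω
  refine ⟨fun k ↦ ?_, ?_, fun k ↦ ?_⟩
  · rw [hY]
    exact hg.comp (measurable_pi_lambda _ fun i ↦ hD.measurable _)
  · rw [funext hY]
    exact (hD.iIndepFun_blocks 2).comp _ fun _ ↦ hg
  · have h1 := ((hD.identDistrib_block 2 k).comp hg).map_eq
    have h2 := ((hD.identDistrib_block 2 0).comp hg).map_eq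
    rw [hY k, hY 0]
    exact h1.trans h2.symm

lemma charFun_evenIncr [IsProbabilityMeasure P] {a γ : ℝ} {ν : Measure ℝ}
    (hX : IsLevyProcess X P) (hT : HasGeneratingTriplet X P a γ ν) (n : ℕ) (θ : ℝ) :
    charFun (P.map (evenIncr X n 0)) θ =
      (Real.exp (-(2 * (1 / n : ℝ) * symExponent a ν θ)) : ℝ) := by
  have hD := hX.isIID_increments n
  have hY : evenIncr X n 0 = fun ω ↦
      (X (((1 + 1 : ℕ) : ℝ≥0) / n) ω - X (((1 : ℕ) : ℝ≥0) / n) ω) -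
      (X (((0 + 1 : ℕ) : ℝ≥0) / n) ω - X (((0 : ℕ) : ℝ≥0) / n) ω) :=
    funext fun ω ↦ evenIncr_eq X n 0 ω
  have hlaw (k : ℕ) : charFun (P.map fun ω ↦
      X (((k + 1 : ℕ) : ℝ≥0) / n) ω - X ((k : ℝ≥0) / n) ω) θ =
      Complex.exp ((1 / n : ℝ) * levyExponent a γ ν θ) := by
    rw [hD.law, hT.charFun_eq]
    simp
  rw [hY, charFun_map_sub_eq_norm_sq (hD.measurable 1).aemeasurable (hD.measurable 0).aemeasurable
    (hD.indep.indepFun one_ne_zero) (hlaw 1) (hlaw 0),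
    norm_exp_levyExponent hT.levyMeasure]

lemma irStat_sub_eq {Ω : Type*} (X : ℝ≥0 → Ω → ℝ) (μ : Measure ℝ) {m : ℕ} (hm : 2 ≤ m) (ω : Ω) :
    irStat X (2 * m) ω - limitMean μ =
      1 / ((m : ℝ) - 1) * ∑ k ∈ Finset.range (m - 1), psiFluct (evenIncr X (2 * m)) μ k ω := by
  have h1 : (2 : ℝ) ≤ m := by exact_mod_cast hm
  have h2 : (m : ℝ) - 1 ≠ 0 := by linarith
  rw [irStat_two_mul]
  simp only [psiFluct, Finset.sum_sub_distrib, Finset.sum_const, Finset.card_range, nsmul_eq_mul]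
  rw [Nat.cast_sub (by lia)]
  push_cast
  field_simp

lemma measurable_irStat [IsProbabilityMeasure P] (hX : IsLevyProcess X P) (m : ℕ) :
    Measurable (irStat X (2 * m)) := by
  have h : irStat X (2 * m) = fun ω ↦ 1 / ((m : ℝ) - 1) * ∑ k ∈ Finset.range (m - 1),
      psi (evenIncr X (2 * m) k ω) (evenIncr X (2 * m) (k + 1) ω) :=
    funext fun ω ↦ irStat_two_mul X m ω
  rw [h]
  have hY := (hX.isIID_evenIncr (2 * m)).measurable
  exact (Finset.measurable_sum _ fun k _ ↦ (hY k).psi (hY (k + 1))).const_mul _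

lemma integral_irStat [IsProbabilityMeasure P] (hX : IsLevyProcess X P) {m : ℕ} (hm : 2 ≤ m) :
    ∫ ω, irStat X (2 * m) ω ∂P = limitMean (P.map (evenIncr X (2 * m) 0)) := by
  have hY := hX.isIID_evenIncr (2 * m)
  have : IsProbabilityMeasure (P.map (evenIncr X (2 * m) 0)) :=
    Measure.isProbabilityMeasure_map (hY.measurable 0).aemeasurable
  have h1 (ω : Ω) := sub_eq_iff_eq_add.1 (irStat_sub_eq X (P.map (evenIncr X (2 * m) 0)) hm ω)
  simp only [h1]
  have h2 : Integrable (fun ω ↦ 1 / ((m : ℝ) - 1) * ∑ k ∈ Finset.range (m - 1),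
      psiFluct (evenIncr X (2 * m)) (P.map (evenIncr X (2 * m) 0)) k ω) P :=
    (integrable_finsetSum _ fun k _ ↦ hY.integrable_psiFluct k).const_mul _
  rw [integral_add h2 (integrable_const _), integral_const_mul,
    integral_finsetSum _ fun k _ ↦ hY.integrable_psiFluct k]
  simp [hY.integral_psiFluct]

/-! ### The limit theorems -/

section Limit

variable {a γ α c : ℝ} {ν : Measure ℝ}

/-- Small time limit of the difference of two independent copies. -/
lemma tendstoInDistribution_copies (hT : HasGeneratingTriplet X P a γ ν)
    (hα : 0 < α) (hc : 0 < c) (hG : HasStableGrowth a ν α c) {S : ProbabilityMeasure ℝ}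
    (hS : IsStdStable α (S : Measure ℝ)) {Ω' : Type*} [MeasurableSpace Ω'] {P' : Measure Ω'}
    [IsProbabilityMeasure P'] {X₁ X₂ : ℝ≥0 → Ω' → ℝ} (hcop : AreIndepCopies X₁ X₂ P' X P) :
    TendstoInDistribution
      (fun (t : ℝ≥0) ω ↦ (t : ℝ) ^ (-(1 / α)) * (X₁ t ω - X₂ t ω)) (𝓝[>] 0)
      (fun z : ℝ ↦ c * z) (fun _ ↦ P') (S : Measure ℝ) := by
  have h1 (t : ℝ≥0) : IdentDistrib (X₁ t) (X t) P' P :=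
    hcop.copy_fst.comp (u := fun x : ℝ≥0 → ℝ ↦ x t) (measurable_pi_apply t)
  have h2 (t : ℝ≥0) : IdentDistrib (X₂ t) (X t) P' P :=
    hcop.copy_snd.comp (u := fun x : ℝ≥0 → ℝ ↦ x t) (measurable_pi_apply t)
  have h12 (t : ℝ≥0) : IndepFun (X₁ t) (X₂ t) P' :=
    hcop.indep.comp (φ := fun x : ℝ≥0 → ℝ ↦ x t) (ψ := fun x : ℝ≥0 → ℝ ↦ x t)
      (measurable_pi_apply t) (measurable_pi_apply t)
  have hm (t : ℝ≥0) : AEMeasurable (fun ω ↦ X₁ t ω - X₂ t ω) P' :=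
    (h1 t).aemeasurable_fst.sub (h2 t).aemeasurable_fst
  have hτ : Tendsto (fun t : ℝ≥0 ↦ (t : ℝ)) (𝓝[>] 0) (𝓝[>] 0) := by
    refine tendsto_nhdsWithin_iff.2 ⟨?_, ?_⟩
    · exact (NNReal.continuous_coe.tendsto 0).mono_left nhdsWithin_le_nhds
    · filter_upwards [self_mem_nhdsWithin] with t ht using NNReal.coe_pos.2 ht
  refine ⟨fun t ↦ (hm t).const_mul _, by fun_prop, ?_⟩
  refine hG.tendsto_map hα hc hS hτ (Eventually.of_forall fun t θ ↦ ?_)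
  rw [ProbabilityMeasure.coe_mk, charFun_map_mul_comp (hm t),
    charFun_map_sub_eq_norm_sq (h1 t).aemeasurable_fst (h2 t).aemeasurable_fst (h12 t)
      (φ := Complex.exp ((t : ℝ) * levyExponent a γ ν ((t : ℝ) ^ (-(1 / α)) * θ)))
      (by rw [(h1 t).map_eq, hT.charFun_eq]) (by rw [(h2 t).map_eq, hT.charFun_eq]),
    norm_exp_levyExponent hT.levyMeasure]

variable [IsProbabilityMeasure P]

/-- The law of one second order increment over a grid of step `1 / (2 m)`. -/
noncomputable def incrLaw (hX : IsLevyProcess X P) (m : ℕ) : ProbabilityMeasure ℝ :=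
  ⟨P.map (evenIncr X (2 * m) 0), Measure.isProbabilityMeasure_map
    ((hX.isIID_evenIncr (2 * m)).measurable 0).aemeasurable⟩

lemma tendsto_step : Tendsto (fun m : ℕ ↦ 1 / ((2 * m : ℕ) : ℝ)) atTop (𝓝[>] 0) := by
  have h : Tendsto (fun m : ℕ ↦ ((2 * m : ℕ) : ℝ)) atTop atTop :=
    tendsto_natCast_atTop_atTop.comp (tendsto_id.const_mul_atTop' two_pos)
  refine tendsto_nhdsWithin_iff.2 ⟨tendsto_const_nhds.div_atTop h, ?_⟩
  filter_upwards [h.eventually_gt_atTop 0] with m hm using one_div_pos.2 hm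

lemma charFun_incrLaw_map (hX : IsLevyProcess X P) (hT : HasGeneratingTriplet X P a γ ν) (m : ℕ)
    (b θ : ℝ) : charFun (((incrLaw hX m).map (f := (b * ·)) (by fun_prop) :
      ProbabilityMeasure ℝ) : Measure ℝ) θ =
      (Real.exp (-(2 * (1 / ((2 * m : ℕ) : ℝ)) * symExponent a ν (b * θ))) : ℝ) := by
  rw [ProbabilityMeasure.toMeasure_map, charFun_map_mul]
  exact charFun_evenIncr hX hT (2 * m) (b * θ)

/-- The stable law exists, as a limit of rescaled increments of the Lévy process. -/
lemma exists_isStdStable (hX : IsLevyProcess X P) (hT : HasGeneratingTriplet X P a γ ν)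
    (hα : 0 < α) (hc : 0 < c) (hG : HasStableGrowth a ν α c) :
    ∃ S : ProbabilityMeasure ℝ, IsStdStable α (S : Measure ℝ) := by
  have hcont : Continuous fun θ : ℝ ↦ Complex.exp (-((|θ| ^ α : ℝ) : ℂ)) := by
    have : Continuous fun θ : ℝ ↦ |θ| ^ α := continuous_abs.rpow_const fun _ ↦ Or.inr hα.le
    fun_prop
  refine exists_charFun_eq_of_tendsto (μ := fun m ↦ (incrLaw hX m).map
    (f := ((1 / ((2 * m : ℕ) : ℝ)) ^ (-(1 / α)) * c⁻¹ * ·)) (by fun_prop))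
    hcont.continuousAt fun θ ↦ ?_
  have h1 := (hG.tendsto_exp hα hc (c⁻¹ * θ)).comp tendsto_step
  rw [mul_inv_cancel_left₀ hc.ne'] at h1
  have h2 := (Complex.continuous_ofReal.tendsto _).comp h1
  rw [Complex.ofReal_exp, Complex.ofReal_neg] at h2
  refine h2.congr fun m ↦ ?_
  rw [charFun_incrLaw_map hX hT, mul_assoc _ c⁻¹ θ]
  rfl

lemma tendsto_incrLaw (hX : IsLevyProcess X P) (hT : HasGeneratingTriplet X P a γ ν)
    (hα : 0 < α) (hc : 0 < c) (hG : HasStableGrowth a ν α c) {S : ProbabilityMeasure ℝ}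
    (hS : IsStdStable α (S : Measure ℝ)) :
    Tendsto (fun m ↦ (incrLaw hX m).map
      (f := ((1 / ((2 * m : ℕ) : ℝ)) ^ (-(1 / α)) * ·)) (by fun_prop)) atTop
      (𝓝 (S.map (f := (c * ·)) (by fun_prop))) :=
  hG.tendsto_map hα hc hS tendsto_step
    (Eventually.of_forall fun m θ ↦ charFun_incrLaw_map hX hT m _ θ)

lemma eventually_scale_ne_zero (α : ℝ) :
    ∀ᶠ m : ℕ in atTop, (1 / ((2 * m : ℕ) : ℝ)) ^ (-(1 / α)) ≠ 0 := by
  filter_upwards [eventually_gt_atTop 0] with m hm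
  positivity

lemma tendsto_integral_irStat (hX : IsLevyProcess X P) (hT : HasGeneratingTriplet X P a γ ν)
    (hα : 0 < α) (hc : 0 < c) (hG : HasStableGrowth a ν α c) {S : ProbabilityMeasure ℝ}
    (hS : IsStdStable α (S : Measure ℝ)) :
    Tendsto (fun m : ℕ ↦ ∫ ω, irStat X (2 * m) ω ∂P) atTop (𝓝 (limitMean (S : Measure ℝ))) := by
  refine (tendsto_limitMean (eventually_scale_ne_zero α) hc.ne'
    (tendsto_incrLaw hX hT hα hc hG hS) (hS.measure_singleton_zero hα)).congr' ?_
  filter_upwards [eventually_ge_atTop 2] with m hm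
  rw [integral_irStat hX hm]
  rfl

lemma ae_tendsto_irStat (hX : IsLevyProcess X P) (hT : HasGeneratingTriplet X P a γ ν)
    (hα : 0 < α) (hc : 0 < c) (hG : HasStableGrowth a ν α c) {S : ProbabilityMeasure ℝ}
    (hS : IsStdStable α (S : Measure ℝ)) :
    ∀ᵐ ω ∂P, Tendsto (fun m : ℕ ↦ irStat X (2 * m) ω) atTop
      (𝓝 (limitMean (S : Measure ℝ))) := by
  have hmean := tendsto_limitMean (eventually_scale_ne_zero α) hc.ne'
    (tendsto_incrLaw hX hT hα hc hG hS) (hS.measure_singleton_zero hα)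
  -- the rows with fewer than two terms are skipped
  have h := ae_tendsto_average (P := P) (Y := fun m ↦ evenIncr X (2 * (m + 3)))
    (μ := fun m ↦ (incrLaw hX (m + 3) : Measure ℝ)) (fun m ↦ hX.isIID_evenIncr (2 * (m + 3)))
    (N := fun m ↦ m + 2) fun m ↦ le_rfl
  filter_upwards [h] with ω hω
  rw [← tendsto_add_atTop_iff_nat 3]
  have h1 := hω.add ((tendsto_add_atTop_iff_nat 3).2 hmean)
  rw [zero_add] at h1
  refine h1.congr fun m ↦ ?_
  have h2 := irStat_sub_eq X (incrLaw hX (m + 3) : Measure ℝ) (m := m + 3) (by lia) ω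
  rw [sub_eq_iff_eq_add.1 h2]
  have h3 : m + 3 - 1 = m + 2 := rfl
  rw [h3]
  push_cast
  ring

/-- Central limit theorem for the increment ratio statistic. -/
lemma tendstoInDistribution_irStat (hX : IsLevyProcess X P) (hT : HasGeneratingTriplet X P a γ ν)
    (hα : 0 < α) (hc : 0 < c) (hG : HasStableGrowth a ν α c) {S : ProbabilityMeasure ℝ}
    (hS : IsStdStable α (S : Measure ℝ)) :
    ∃ v : ℝ≥0, (v : ℝ) = limitVariance (S : Measure ℝ) ∧
      TendstoInDistribution
        (fun (m : ℕ) ω ↦ √((2 * m : ℕ) : ℝ) *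
          (irStat X (2 * m) ω - ∫ ω', irStat X (2 * m) ω' ∂P)) atTop
        (fun x : ℝ ↦ x) (fun _ ↦ P) (gaussianReal 0 v) := by
  have hlim := tendsto_incrLaw hX hT hα hc hG hS
  have h0 := hS.measure_singleton_zero hα
  have hv := tendsto_psiVar (eventually_scale_ne_zero α) hc.ne' hlim h0
  have hκ := tendsto_psiCov (eventually_scale_ne_zero α) hc.ne' hlim h0
  have hY (m : ℕ) : IsIID (evenIncr X (2 * m)) (incrLaw hX m : Measure ℝ) P :=
    hX.isIID_evenIncr (2 * m)
  have hV : limitVariance (S : Measure ℝ) =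
      2 * (psiVar (S : Measure ℝ) + 2 * psiCov (S : Measure ℝ)) := by
    rw [limitVariance, psiVar, psiCov]
    ring
  have hV0 : 0 ≤ limitVariance (S : Measure ℝ) := by
    rw [hV]
    exact mul_nonneg zero_le_two (psiVar_add_two_mul_psiCov_nonneg hY hv hκ)
  refine ⟨(limitVariance (S : Measure ℝ)).toNNReal, Real.coe_toNNReal _ hV0, fun m ↦
    (((measurable_irStat hX m).sub_const _).const_mul _).aemeasurable, by fun_prop, ?_⟩
  refine tendsto_probabilityMeasure_of_charFun fun θ ↦ ?_
  -- the normalization satisfies `b m ^ 2 * (m - 1) → 2`, which turns `v + 2 κ` into the limit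
  -- variance
  have hN : Tendsto (fun m : ℕ ↦ m - 1) atTop atTop := tendsto_sub_atTop_nat 1
  have hb : Tendsto (fun m : ℕ ↦ (√((2 * m : ℕ) : ℝ) * (1 / ((m : ℝ) - 1))) ^ 2 *
      ((m - 1 : ℕ) : ℝ)) atTop (𝓝 2) := by
    have h1 : Tendsto (fun m : ℕ ↦ 2 + 2 * (1 / ((m : ℝ) - 1))) atTop (𝓝 (2 + 2 * 0)) := by
      refine ((tendsto_const_nhds.div_atTop ?_).const_mul 2).const_add 2
      exact tendsto_atTop_add_const_right _ _ tendsto_natCast_atTop_atTop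
    rw [mul_zero, add_zero] at h1
    refine h1.congr' ?_
    filter_upwards [eventually_ge_atTop 2] with m hm
    have h2 : (2 : ℝ) ≤ m := by exact_mod_cast hm
    have h3 : (m : ℝ) - 1 ≠ 0 := by linarith
    rw [mul_pow, Real.sq_sqrt (by positivity), Nat.cast_sub (by lia)]
    push_cast
    field_simp
    ring
  have key := tendsto_charFun_array hY hN hb hv hκ θ
  have hgauss : charFun (gaussianReal 0 (limitVariance (S : Measure ℝ)).toNNReal) θ =
      (Real.exp (-(2 * (psiVar (S : Measure ℝ) + 2 * psiCov (S : Measure ℝ)) * θ ^ 2 / 2)) : ℂ) := by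
    rw [charFun_gaussianReal, ← hV, Real.coe_toNNReal _ hV0]
    push_cast
    congr 1
    ring
  simp only [ProbabilityMeasure.coe_mk, Measure.map_id']
  rw [hgauss]
  refine key.congr' ?_
  filter_upwards [eventually_ge_atTop 2] with m hm
  congr 2
  ext ω
  rw [integral_irStat hX hm, irStat_sub_eq X _ hm]
  simp only [mul_assoc]
  rfl

end Limit

/-! ### The growth of the exponent in the two cases -/

lemma IsLevyMeasure.hasStableGrowth_gaussian {ν : Measure ℝ} (h : IsLevyMeasure ν) (a : ℝ) :
    HasStableGrowth a ν 2 a := by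
  have h1 := (h.tendsto_jumpExponent_div_sq.const_mul 2).const_add (a ^ 2)
  rw [mul_zero, add_zero] at h1
  unfold HasStableGrowth
  rw [Real.rpow_two]
  refine h1.congr' ?_
  filter_upwards [eventually_gt_atTop 0] with θ hθ
  rw [Real.rpow_two, symExponent]
  field_simp

/-- The scale of the stable limit of a Lévy process without Brownian component. No Lévy measure has
a tail of order `u⁻²` at the origin, so the value for `α = 2` is arbitrary. -/
noncomputable def stableScale (α c : ℝ) : ℝ :=
  if α < 2 then (2 * c * stableConst α) ^ (1 / α) else 1

lemma stableScale_pos {α c : ℝ} (hα : 0 < α) (hc : 0 < c) : 0 < stableScale α c := by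
  unfold stableScale
  split_ifs with h
  · have := stableConst_pos hα h
    positivity
  · exact one_pos

lemma IsLevyMeasure.hasStableGrowth_jumps {ν : Measure ℝ} (h : IsLevyMeasure ν) {α c : ℝ}
    (hα : 0 < α) (hα2 : α ≤ 2) (hc : 0 < c) (hK : symTail ν ~[𝓝[>] 0] (fun u ↦ c / u ^ α)) :
    HasStableGrowth 0 ν α (stableScale α c) := by
  rcases hα2.lt_or_eq with hlt | rfl
  · have h0 := stableConst_pos hα hlt
    unfold HasStableGrowth stableScale
    rw [if_pos hlt, ← Real.rpow_mul (by positivity), one_div_mul_cancel hα.ne', Real.rpow_one,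
      mul_assoc]
    refine ((h.tendsto_jumpExponent_div_rpow hα hlt hc hK).const_mul 2).congr fun θ ↦ ?_
    rw [symExponent]
    ring
  · exact (h.not_isEquivalent_sq hc hK).elim

end LevyIR

theorem proposition5p2 :
    ∃ κ : ℝ → ℝ → ℝ, (∀ α c : ℝ, 0 < α → α ≤ 2 → 0 < c → 0 < κ α c) ∧
      ∀ (Ω : Type*) [MeasurableSpace Ω] (P : Measure Ω) [IsProbabilityMeasure P]
        (X : ℝ≥0 → Ω → ℝ) (a γ : ℝ) (ν : Measure ℝ),
        LevyIR.IsLevyProcess X P → LevyIR.HasGeneratingTriplet X P a γ ν →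
        ∀ α c' : ℝ,
          ((0 < a ∧ α = 2 ∧ c' = a) ∨
            (a = 0 ∧ 0 < α ∧ α ≤ 2 ∧ ∃ c : ℝ, 0 < c ∧
              LevyIR.symTail ν ~[𝓝[>] 0] (fun u ↦ c / u ^ α) ∧ c' = κ α c)) →
          -- `S` is the law of the standard `α`-stable variable (unique by its transform)
          ∃ S : ProbabilityMeasure ℝ, LevyIR.IsStdStable α (S : Measure ℝ) ∧
            -- small time limit of the symmetrized process
            (∀ (Ω' : Type*) [MeasurableSpace Ω'] (P' : Measure Ω') [IsProbabilityMeasure P']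
              (X₁ X₂ : ℝ≥0 → Ω' → ℝ), LevyIR.AreIndepCopies X₁ X₂ P' X P →
              TendstoInDistribution
                (fun (t : ℝ≥0) ω ↦ (t : ℝ) ^ (-(1 / α)) * (X₁ t ω - X₂ t ω)) (𝓝[>] 0)
                (fun z : ℝ ↦ c' * z) (fun _ ↦ P') (S : Measure ℝ)) ∧
            -- convergence of the mean, along even `n = 2 * m`
            Tendsto (fun m : ℕ ↦ ∫ ω, LevyIR.irStat X (2 * m) ω ∂P) atTop
              (𝓝 (LevyIR.limitMean (S : Measure ℝ))) ∧
            -- almost sure convergence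
            (∀ᵐ ω ∂P, Tendsto (fun m : ℕ ↦ LevyIR.irStat X (2 * m) ω) atTop
              (𝓝 (LevyIR.limitMean (S : Measure ℝ)))) ∧
            -- central limit theorem
            ∃ v : ℝ≥0, (v : ℝ) = LevyIR.limitVariance (S : Measure ℝ) ∧
              TendstoInDistribution
                (fun (m : ℕ) ω ↦ √((2 * m : ℕ) : ℝ) *
                  (LevyIR.irStat X (2 * m) ω - ∫ ω', LevyIR.irStat X (2 * m) ω' ∂P)) atTop
                (fun x : ℝ ↦ x) (fun _ ↦ P) (gaussianReal 0 v) := by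
  refine ⟨LevyIR.stableScale, fun α c hα _ hc ↦ LevyIR.stableScale_pos hα hc, ?_⟩
  intro Ω _ P _ X a γ ν hX hT α c' hcase
  have hgrowth : 0 < α ∧ 0 < c' ∧ LevyIR.HasStableGrowth a ν α c' := by
    rcases hcase with ⟨ha, rfl, rfl⟩ | ⟨rfl, hα, hα2, c, hc, hK, rfl⟩
    · exact ⟨two_pos, ha, LevyIR.IsLevyMeasure.hasStableGrowth_gaussian hT.levyMeasure c'⟩
    · exact ⟨hα, LevyIR.stableScale_pos hα hc,
        LevyIR.IsLevyMeasure.hasStableGrowth_jumps hT.levyMeasure hα hα2 hc hK⟩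
  obtain ⟨hα, hc, hG⟩ := hgrowth
  obtain ⟨S, hS⟩ := LevyIR.exists_isStdStable hX hT hα hc hG
  exact ⟨S, hS, fun Ω' _ P' _ X₁ X₂ hcop ↦
    LevyIR.tendstoInDistribution_copies hT hα hc hG hS hcop,
    LevyIR.tendsto_integral_irStat hX hT hα hc hG hS,
    LevyIR.ae_tendsto_irStat hX hT hα hc hG hS,
    LevyIR.tendstoInDistribution_irStat hX hT hα hc hG hS⟩
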